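/- **Setting.** Let $G=(\mathcal V,\mathcal E)$, $\mathcal V=\{1,\dots,m\}$, be a connected undirected graph with neighbourhoods $\mathcal N_i$, and $t\in\{1,\dots,T\}$, $T\ge 1$. Agent $i$ controls $p_i=(p_{i,j,t})_{j\in\mathcal N_i,\,t}$. Consider $$\min_p\ \sum_{i,t}\sum_{j\in\mathcal N_i}\Big(\tfrac12 a_{i,j,t}p_{i,j,t}^2+\tilde b_{i,j,t}p_{i,j,t}+c_{i,j,t}+\hat b_{i,j,t}p_{i,j,t}-\bar b_{i,j,t}p_{i,j,t}\Big)$$ with $a_{i,j,t}>0$, subject to $p_{i,j,t}+p_{j,i,t}=l_{i,j,t}$ and $p_i\in\mathcal S_i$ for all $i$, where $\mathcal S_i$ is given by $\hat p^{\min}_{i,t}\le\sum_{j\in\mathcal N_i}p_{i,j,t}\le\hat p^{\max}_{i,t}$, $p_{i,j,t}\ge0$ if $i$ is a seller in period $t$, and $p_{i,j,t}\le 0$ if $i$ is a buyer in period $t$. Assume that a solution exists and that some point satisfies the equalities, and all inequalities strictly. Put $A_i=\mathrm{diag}(a_{i,j,t})$, $b_i=(\tilde b_{i,j,t}+\hat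 b_{i,j,t}-\bar b_{i,j,t})$, $f(x)=\sum_i(\tfrac12x_i^\top A_ix_i+b_i^\top x_i)$, $g=\sum_i \mathcal I_{\mathcal S_i}$ (indicator functions), $L_f=\max a_{i,j,t}$, $\mu=\min a_{i,j,t}$, $\kappa_f=L_f/\mu$. Let $\Omega_{ij}p_i=(p_{i,j,t})_t$; let $w=(w_{(i,j),i})$ with $w_{(i,j),i}\in\mathbb R^T$ for each edge and each endpoint of it; let $\Psi p=(\Omega_{ij}p_i)_{(i,j),i}$; and let $\mathcal S^r=\{z: z_{(i,j),i}+z_{(i,j),j}=l_{ij}\text{ for all edges}\}$. With $U=(w,x)$, the set of primal–dual solutions is $$\mathcal S^*=\{(w,x):\ 0\in\partial \mathcal I_{\mathcal S^r}^{\otimes}(w)-\Psi x,\quad 0\in\partial g(x)+\nabla f(x)+\Psi^\top w\},$$ where $\mathcal I_{\mathcal S^r}^{\otimes}$ is the Fenchel conjugate of the indicator function of $\mathcal S^r$. **Operators.** For step-sizes $\alpha_i,\beta_{(i,j)}>0$ with $\alpha_i\le 1/\big(\kappa_f L_f/2+\|\sum_{j\in\mathcal N_i}\beta_{(i,j)}\Omega_{ij}^\top\Omega_{ij}\|\big)$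 and $U=(w,x)$ put $$\bar w_{(i,j),i}=\tfrac{\beta_{(i,j)}}2(\Omega_{ij}x_i+\Omega_{ji}x_j-l_{ij})+\tfrac12(w_{(i,j),i}+w_{(i,j),j}),\qquad \bar x_i=\mathcal P_{\mathcal S_i}\Big\{x_i-\alpha_i\Big(A_ix_i+b_i+\sum_{j\in\mathcal N_i}\Omega_{ij}^\top\bar w_{(i,j),i}\Big)\Big\},$$ where $\mathcal P$ is the Euclidean projection, let $\mathbb TU=\big((\bar w_{(i,j),i}+\beta_{(i,j)}\Omega_{ij}(\bar x_i-x_i)),(\bar x_i)\big)$, $\mathbb Z=\mathrm{Id}-\mathbb T$, and let $\mathbb Z_i$ be $\mathbb Z$ with all components except those owned by agent $i$ (namely $x_i$ and $w_{(i,j),i}$, $j\in\mathcal N_i$) replaced by $0$. Let $\mathbb T_s$ be the diagonal operator with entries $1/\beta_{(i,j)}$ on $w_{(i,j),i}$ and $1/\alpha_i$ on $x_i$, $\|X\|^2_{\mathbb T_s}=\langle X,\mathbb T_sX\rangle$, and $\kappa_s=\lambda_{\max}(\mathbb T_s)/\lambda_{\min}(\mathbb T_s)$. **Algorithm (Asyn-DYNA).**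 From an arbitrary deterministic $U^0$, set $U^{k+1}=U^k-\theta_{i_k}\mathbb Z_{i_k}\hat U^k$, where $\hat U^k$ has the primal components $x_i^{k-\tau_i^k}$ and the dual components $w_{(i,j),i}^{k-\varsigma_{(i,j)}^k}$, with (possibly random) delays $0\le\tau_i^k,\varsigma_{(i,j)}^k\le d$; here and below $U^{n}=U^0$ for $n<0$. The activated agents $i_0,i_1,\dots$ are independent, $\mathbb P(i_k=i)=P_i\in(0,1)$, and $i_k$ is independent of $\mathcal F^k=\sigma(U^0,\hat U^1,U^1,\dots,\hat U^k,U^k)$. Let $P_{\min}=\min_i P_i$, $P_{\max}=\max_i P_i$, $\kappa_P=P_{\max}/P_{\min}$. The relaxation factors $\theta_i$ are such that $\tilde\theta:=m\theta_iP_i$ does not depend on $i$. Put $\tilde U^{k+1}=U^k-\tilde\theta\,\mathbb Z\hat U^k$, $V^k=(U^{k-l})_{l=0}^d$, $V^*=(U^*)_{l=0}^d$, and $\|Y\|_\Theta^2=\langle Y,\Theta Y\rangle$, where, with $s=\sqrt{P_{\min}/\kappa_s}$, the operator $\Theta$ maps $(y_l)_{l=0}^d$ to $(\tilde y_l)_{l=0}^d$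 with $\tilde y_0=\mathbb T_s(y_0+ds(y_0-y_1))$, $\tilde y_l=s\,\mathbb T_s\big((l-d-1)y_{l-1}+(2d-2l+1)y_l+(l-d)y_{l+1}\big)$ for $0<l<d$, and $\tilde y_d=s\,\mathbb T_s(y_d-y_{d-1})$ (for $d=0$ only $\tilde y_0=\mathbb T_sy_0$). **Theorem.** If $0<\theta_i\le 1/\big(2d\sqrt{\kappa_s\kappa_P}+\kappa_s\kappa_P\big)$ for all $i$, then $\varpi:=1/(\theta_iP_i)-2d\sqrt{\kappa_s/P_{\min}}-\kappa_s/P_{\min}\ge0$, and for every $U^*\in\mathcal S^*$ and every $k\ge0$ the variable $\|V^{k+1}-V^*\|_\Theta^2$ is integrable and, almost surely, $$\mathbb E\big[\|V^{k+1}-V^*\|_\Theta^2\,\big|\,\mathcal F^k\big]\le\|V^k-V^*\|_\Theta^2-\frac{\varpi}{m^2}\big\|\tilde U^{k+1}-U^k\big\|_{\mathbb T_s}^2 .$$ Moreover, almost surely, $U^k$ converges to some (random) $U^*\in\mathcal S^*$. -/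

import Mathlib

open MeasureTheory ProbabilityTheory Filter Topology
open scoped Matrix

noncomputable section

namespace DYNA

variable {m T : ℕ}

/-! ### Vectors

Agents are the elements of `Fin m`, periods the elements of `Fin T`. The variable of agent `i` is
indexed by a trader `j` (a neighbour of `i`) and a period `t`. -/

/-- `ℝ^{T |N_i|}`: the space of `p_i = (p_{i,j,t})_{j, t}`. -/
abbrev Block (G : SimpleGraph (Fin m)) (T : ℕ) (i : Fin m) : Type :=
  G.neighborSet i × Fin T → ℝ

/-- The space of `p = col {p_i}`. The dual variable `w` lives in the same space: the component
`w_{(i,j),i} ∈ ℝ^T` of the edge variable `w_{(i,j)} = [w_{(i,j),i}; w_{(i,j),j}]` is stored as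
`fun t => w i (j, t)`, and `w_{(i,j),j}` as `fun t => w j (i, t)`. -/
abbrev Stack (G : SimpleGraph (Fin m)) (T : ℕ) : Type := (i : Fin m) → Block G T i

/-- The primal-dual state `U = [w; x]`: `U.1` is `w` and `U.2` is `x = p`. -/
abbrev State (G : SimpleGraph (Fin m)) (T : ℕ) : Type := Stack G T × Stack G T

/-- For a neighbour `j` of `i`, the agent `i` seen as a neighbour of `j`. -/
def back {G : SimpleGraph (Fin m)} {i : Fin m} (j : G.neighborSet i) : G.neighborSet j.1 :=
  ⟨i, G.adj_symm j.2⟩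

section Linear

variable (G : SimpleGraph (Fin m)) [DecidableRel G.Adj]

/-- The selection matrix `Ω_{ij}`, with `Ω_{ij} p_i = (p_{i,j,t})_t`. -/
def Omega (i : Fin m) (j : G.neighborSet i) :
    Matrix (Fin T) (G.neighborSet i × Fin T) ℝ :=
  fun t c => if c = (j, t) then 1 else 0

/-- The matrix `Ψ`: its components for the edge `(i,j)` are `Ω_{ij} p_i` and `Ω_{ji} p_j`. -/
def Psi (p : Stack G T) : Stack G T := fun i c => (Omega G i c.1 *ᵥ p i) c.2

/-- The transpose of `Ψ`: its `i`-th block is `∑_{j ∈ N_i} Ω_{ij}ᵀ w_{(i,j),i}`. -/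
def PsiT (w : Stack G T) : Stack G T :=
  fun i => ∑ j : G.neighborSet i, (Omega G i j)ᵀ *ᵥ (fun t : Fin T => w i (j, t))

/-- Euclidean inner product of stacked vectors. -/
def dot (u v : Stack G T) : ℝ := ∑ i, u i ⬝ᵥ v i

/-- Euclidean inner product of states. -/
def ip (X Y : State G T) : ℝ := dot G X.1 Y.1 + dot G X.2 Y.2

end Linear

/-! ### Convex analysis -/

open Classical in
/-- The indicator function of a set, with values `0` and `+∞`. -/
def indic {E : Type*} (S : Set E) (x : E) : EReal := if x ∈ S then 0 else ⊤

/-- The Fenchel conjugate `h^⊗`. -/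
def conj (G : SimpleGraph (Fin m)) [DecidableRel G.Adj] (h : Stack G T → EReal)
    (w : Stack G T) : EReal := ⨆ y : Stack G T, ((dot G w y : ℝ) : EReal) - h y

/-- The convex subdifferential of an extended-real valued function. -/
def subdiff (G : SimpleGraph (Fin m)) [DecidableRel G.Adj] (h : Stack G T → EReal)
    (x : Stack G T) : Set (Stack G T) :=
  {v | h x ≠ ⊤ ∧ h x ≠ ⊥ ∧ ∀ y, h x + ((dot G v (y - x) : ℝ) : EReal) ≤ h y}

/-- `y` is a Euclidean projection of `x` onto `S`. -/
def IsProj {ι : Type*} [Fintype ι] (S : Set (ι → ℝ)) (x y : ι → ℝ) : Prop :=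
  y ∈ S ∧ ∀ z ∈ S, ∑ c, (x c - y c) ^ 2 ≤ ∑ c, (x c - z c) ^ 2

/-- The Euclidean projection `P_S{x}`; it is only used for nonempty closed convex sets, where the
projection exists and is unique. -/
def proj {ι : Type*} [Fintype ι] (S : Set (ι → ℝ)) (x : ι → ℝ) : ι → ℝ :=
  Classical.epsilon (IsProj S x)

/-- Largest eigenvalue. -/
def lamMax {E : Type*} [AddCommGroup E] [Module ℝ E] (L : Module.End ℝ E) : ℝ :=
  sSup {r | L.HasEigenvalue r}

/-- Smallest eigenvalue. -/
def lamMin {E : Type*} [AddCommGroup E] [Module ℝ E] (L : Module.End ℝ E) : ℝ :=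
  sInf {r | L.HasEigenvalue r}

/-! ### The energy management problem -/

/-- Data of the dynamic peer-to-peer energy management problem on the network `G` over `T`
periods. -/
structure Market (G : SimpleGraph (Fin m)) (T : ℕ) where
  /-- quadratic cost coefficients `a_{i,j,t}` -/
  a : Stack G T
  /-- linear cost coefficients -/
  bcost : Stack G T
  /-- network utilization fee coefficients -/
  bfee : Stack G T
  /-- reputation income coefficients -/
  brep : Stack G T
  /-- constant cost terms -/
  c : Stack G T
  /-- lower bounds on the power set-points -/
  pmin : Fin m → Fin T → ℝ
  /-- upper bounds on the power set-points -/
  pmax : Fin m → Fin T → ℝ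
  /-- transportation losses `l_{i,j,t}` -/
  loss : Stack G T
  /-- energy sellers in each period -/
  seller : Fin T → Set (Fin m)
  /-- energy buyers in each period -/
  buyer : Fin T → Set (Fin m)
  a_pos : ∀ i c, 0 < a i c

namespace Market

variable {G : SimpleGraph (Fin m)} [DecidableRel G.Adj] (M : Market G T)

/-- Total cost: traded cost plus network utilization fee minus reputation income. -/
def cost (p : Stack G T) : ℝ :=
  ∑ t : Fin T, ∑ i : Fin m,
    ((∑ j : G.neighborSet i, (1 / 2 * M.a i (j, t) * p i (j, t) ^ 2
        + M.bcost i (j, t) * p i (j, t) + M.c i (j, t)))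
      + (∑ j : G.neighborSet i, M.bfee i (j, t) * p i (j, t))
      - ∑ j : G.neighborSet i, M.brep i (j, t) * p i (j, t))

/-- Bilateral reciprocity `p_{i,j,t} + p_{j,i,t} = l_{i,j,t}`. -/
def Reciprocal (p : Stack G T) : Prop :=
  ∀ (i : Fin m) (j : G.neighborSet i) (t : Fin T),
    p i (j, t) + p j.1 (back j, t) = M.loss i (j, t)

/-- The local constraint set `S_i`: box constraint on the power set-points and sign constraints. -/
def localSet (i : Fin m) : Set (Block G T i) :=
  {q | (∀ t, M.pmin i t ≤ ∑ j : G.neighborSet i, q (j, t) ∧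
          ∑ j : G.neighborSet i, q (j, t) ≤ M.pmax i t) ∧
       (∀ t, i ∈ M.seller t → ∀ j, 0 ≤ q (j, t)) ∧
       (∀ t, i ∈ M.buyer t → ∀ j, q (j, t) ≤ 0)}

/-- Feasible points of the energy management problem. -/
def Feasible (p : Stack G T) : Prop := M.Reciprocal p ∧ ∀ i, p i ∈ M.localSet i

/-- Solutions of the energy management problem. -/
def IsSolution (p : Stack G T) : Prop :=
  M.Feasible p ∧ ∀ q, M.Feasible q → M.cost p ≤ M.cost q

/-- Points satisfying the reciprocity constraint, and all inequalities strictly. -/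
def StrictlyFeasible (p : Stack G T) : Prop :=
  M.Reciprocal p ∧ ∀ i t,
    (M.pmin i t < ∑ j : G.neighborSet i, p i (j, t) ∧
      ∑ j : G.neighborSet i, p i (j, t) < M.pmax i t) ∧
    (i ∈ M.seller t → ∀ j, 0 < p i (j, t)) ∧
    (i ∈ M.buyer t → ∀ j, p i (j, t) < 0)

/-- The linear coefficient `b`. -/
def b : Stack G T := fun i c => M.bcost i c + M.bfee i c - M.brep i c

/-- The matrix `A_i`. -/
def A (i : Fin m) : Matrix (G.neighborSet i × Fin T) (G.neighborSet i × Fin T) ℝ :=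
  Matrix.diagonal (M.a i)

/-- The gradient of `f(x) = ∑_i (x_iᵀ A_i x_i / 2 + b_iᵀ x_i)`. -/
def gradF (x : Stack G T) : Stack G T := fun i => M.A i *ᵥ x i + M.b i

/-- `g(x) = ∑_i I_{S_i}(x_i)`. -/
def g (x : Stack G T) : EReal := ∑ i, indic (M.localSet i) (x i)

/-- The indicator function of `S^r`. -/
def recipIndic (z : Stack G T) : EReal := indic {z | M.Reciprocal z} z

/-- `L_f = max a_{i,j,t}`. -/
def Lf : ℝ := ⨆ i, ⨆ c, M.a i c

/-- `μ = min a_{i,j,t}`. -/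
def mu : ℝ := ⨅ i, ⨅ c, M.a i c

/-- The condition number of `f`. -/
def kappaF : ℝ := M.Lf / M.mu

/-! ### Monotone operators and primal-dual solutions -/

/-- The set-valued operator `T_A`. -/
def TA (U : State G T) : Set (State G T) :=
  {Y | Y.1 ∈ subdiff G (conj G M.recipIndic) U.1 ∧ Y.2 ∈ subdiff G M.g U.2}

/-- The operator `T_C`. -/
def TC (U : State G T) : State G T := (0, M.gradF U.2)

end Market

/-- The skew operator `T_M`. -/
def TM {G : SimpleGraph (Fin m)} [DecidableRel G.Adj] (U : State G T) : State G T :=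
  (-Psi G U.2, PsiT G U.1)

namespace Market

variable {G : SimpleGraph (Fin m)} [DecidableRel G.Adj] (M : Market G T)

/-- The set `S^*` of primal-dual solutions: `0 ∈ T_A U + T_M U + T_C U`. -/
def solSet : Set (State G T) := {U | ∃ Y ∈ M.TA U, 0 = Y + TM U + M.TC U}

/-! ### The algorithms

`α i` is the primal step-size of agent `i`, `β s(i, j)` the dual step-size of the edge `(i,j)`. -/

variable (α : Fin m → ℝ) (β : Sym2 (Fin m) → ℝ)

/-- Intermediate dual variable `w̄_{(i,j),i}`. -/
def wbar (U : State G T) (i : Fin m) (j : G.neighborSet i) : Fin T → ℝ :=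
  (β s(i, j.1) / 2) • (Omega G i j *ᵥ U.2 i + Omega G j.1 (back j) *ᵥ U.2 j.1
      - fun t => M.loss i (j, t))
    + (1 / 2 : ℝ) • ((fun t => U.1 i (j, t)) + fun t => U.1 j.1 (back j, t))

/-- Intermediate primal variable of agent `i`. -/
def pbar (U : State G T) (i : Fin m) : Block G T i :=
  proj (M.localSet i) (U.2 i - α i • (M.A i *ᵥ U.2 i + M.b i)
    - α i • ∑ j : G.neighborSet i, (Omega G i j)ᵀ *ᵥ M.wbar β U i j)

/-- The synchronous operator `𝕋`: one step of Syn-DYNA. -/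
def syn (U : State G T) : State G T :=
  (fun i c => M.wbar β U i c.1 c.2
      + β s(i, c.1.1) * (Omega G i c.1 *ᵥ (M.pbar α β U i - U.2 i)) c.2,
   fun i => M.pbar α β U i)

/-- `ℤ = Id - 𝕋`. -/
def Zop (U : State G T) : State G T := U - M.syn α β U

/-- The virtual synchronous update `Ũ^{k+1} = U^k - θ̃ ℤ Û^k`, with `U = U^k` and `Uh = Û^k`. -/
def virtual (θt : ℝ) (U Uh : State G T) : State G T := U - θt • M.Zop α β Uh

/-- One step of Asyn-DYNA when agent `ik` is active, with relaxation factors `θ`, current state `U`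
and delayed state `Uh`; the other agents keep their variables. -/
def asynStep (θ : Fin m → ℝ) (ik : Fin m) (U Uh : State G T) : State G T :=
  (fun i c => if i = ik then
      U.1 i c + θ i * (M.wbar β Uh i c.1 c.2 - Uh.1 i c)
        + θ i * β s(i, c.1.1) * (Omega G i c.1 *ᵥ (M.pbar α β Uh i - Uh.2 i)) c.2
    else U.1 i c,
   fun i c => if i = ik then U.2 i c + θ i * (M.pbar α β Uh i c - Uh.2 i c) else U.2 i c)

end Market

/-- The delayed state `Û^k`: primal variables of agent `i` at time `k - τ i`, dual variables of the
edge `e` at time `k - ς e` (time `0` in place of negative times). -/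
def delayed {G : SimpleGraph (Fin m)} (U : ℕ → State G T) (k : ℕ) (τ : Fin m → ℕ)
    (ς : Sym2 (Fin m) → ℕ) : State G T :=
  (fun i c => (U (k - ς s(i, c.1.1))).1 i c, fun i => (U (k - τ i)).2 i)

/-- `F^k = σ(U^0, Û^1, U^1, …, Û^k, U^k)`. -/
@[reducible] def hist {G : SimpleGraph (Fin m)} {Ω : Type*} (U Uh : ℕ → Ω → State G T) (k : ℕ) :
    MeasurableSpace Ω :=
  (⨆ n ∈ Set.Icc 0 k, MeasurableSpace.comap (U n) inferInstance) ⊔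
    ⨆ n ∈ Set.Icc 1 k, MeasurableSpace.comap (Uh n) inferInstance

/-! ### Weighted norms and constants -/

section Weights

variable (G : SimpleGraph (Fin m)) [DecidableRel G.Adj] (α : Fin m → ℝ) (β : Sym2 (Fin m) → ℝ)

/-- The block diagonal operator `T_s = diag(Λ_β⁻¹, Λ_α⁻¹)`. -/
def Ts : Module.End ℝ (State G T) where
  toFun U := (fun i c => (β s(i, c.1.1))⁻¹ * U.1 i c, fun i c => (α i)⁻¹ * U.2 i c)
  map_add' U W := by ext <;> simp [mul_add]
  map_smul' r U := by ext <;> simp [mul_left_comm]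

/-- `‖X‖²` in the `T_s`-norm. -/
def normSqTs (X : State G T) : ℝ := ip G X (Ts G α β X)

/-- The condition number of the step-sizes, i.e. of `T_s`. -/
def kappaS (T : ℕ) : ℝ :=
  lamMax (Ts G α β : Module.End ℝ (State G T)) / lamMin (Ts G α β : Module.End ℝ (State G T))

/-- The spectral norm of `∑_{j ∈ N_i} β_{(i,j)} Ω_{ij}ᵀ Ω_{ij}`. -/
def couplingNorm (T : ℕ) (i : Fin m) : ℝ :=
  ‖Matrix.toEuclideanCLM (n := G.neighborSet i × Fin T) (𝕜 := ℝ)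
    (∑ j : G.neighborSet i, β s(i, j.1) •
      ((Omega G i j)ᵀ * (Omega G i j : Matrix (Fin T) (G.neighborSet i × Fin T) ℝ)))‖

/-- `P_min`. -/
def Pmin (P : Fin m → ℝ) : ℝ := ⨅ i, P i

/-- `P_max`. -/
def Pmax (P : Fin m → ℝ) : ℝ := ⨆ i, P i

/-- The condition number of the activation probabilities. -/
def kappaP (P : Fin m → ℝ) : ℝ := Pmax P / Pmin P

/-- The operator `Θ : col {y_l} ↦ col {ỹ_l}`, `l = 0, …, d`. -/
def Theta (P : Fin m → ℝ) (d : ℕ) (Y : Fin (d + 1) → State G T) : Fin (d + 1) → State G T :=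
  fun l =>
    if l = 0 then
      Ts G α β (Y 0 + ((d : ℝ) * √(Pmin P / kappaS G α β T)) • (Y 0 - Y 1))
    else if l = Fin.last d then
      √(Pmin P / kappaS G α β T) • Ts G α β (Y l - Y (l - 1))
    else
      √(Pmin P / kappaS G α β T) • Ts G α β
        ((((l : ℕ) : ℝ) - d - 1) • Y (l - 1) + (2 * (d : ℝ) - 2 * ((l : ℕ) : ℝ) + 1) • Y l
          + (((l : ℕ) : ℝ) - d) • Y (l + 1))

/-- `‖Y‖²` in the `Θ`-norm, i.e. `⟨Y, Θ Y⟩`. -/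
def normSqTheta (P : Fin m → ℝ) (d : ℕ) (Y : Fin (d + 1) → State G T) : ℝ :=
  ∑ l, ip G (Y l) (Theta G α β P d Y l)

/-- The constant `ϖ = 1/(θ_i P_i) - 2 d √(κ_s/P_min) - κ_s/P_min`. -/
def varpi (T : ℕ) (P θ : Fin m → ℝ) (d : ℕ) (i : Fin m) : ℝ :=
  1 / (θ i * P i) - 2 * d * √(kappaS G α β T / Pmin P) - kappaS G α β T / Pmin P

end Weights

/-- The stacked vector `V^k = col {U^{k-l}}`, `l = 0, …, d` (`U^0` in place of negative times). -/
def stackV {G : SimpleGraph (Fin m)} (U : ℕ → State G T) (d k : ℕ) : Fin (d + 1) → State G T :=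
  fun l => U (k - (l : ℕ))

end DYNA

end

open DYNA

set_option linter.unusedSectionVars false

/-! In coordinates `Psi` and `PsiT` are the identity, and reciprocity reads `p + flip p = loss`,
where `flip` exchanges the two ends of every edge. The directions of the affine space S^r are thus
the antisymmetric stacks, whose orthogonal complement consists of the symmetric ones. The conjugate
of its indicator is linear on symmetric stacks and infinite elsewhere. So (w, x) is a primal-dual
solution exactly when w is symmetric, x is feasible, and ∇f(x) + w satisfies the variational
inequality over the product of the S_i (`mem_solSet_iff`). Slater's condition yields such a pair by
separation (`solSet_nonempty`).

The deterministic core is an algebraic identity (`decrease_eq`): the loss of squared `Ts`-distance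
to a solution under one full step of 𝕋 is a sum of weighted squares plus twice a monotonicity term.
The step-size condition, which implies a/2 + β ≤ 1/α in every coordinate, makes the weights
nonnegative, and optimality together with the projection inequality handles the other term. The loss
vanishes only at solutions (`mem_solSet_of_decrease_eq_zero`).

For the asynchronous step, θ_i P_i = q for all i makes the average of the activated steps equal to q
ℤ, while the averaged second moment costs at most q²/P_min. The delay error telescopes into at most
d successive differences, split by Young's inequality with parameter s. In the Θ-norm, the squared
distance is increased by s ∑ (d - l)‖U^{k-l} - U^{k-l-1}‖². Advancing k lowers each old weight by
one, and this pays for the delay error. What remains is -q · decrease - ϖ q²‖ℤ Û^k‖²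
(`sum_asynStep_le`), and independence turns the average into a conditional expectation.

Since ϖ may be zero, convergence rests on the term q · decrease. A Robbins–Siegmund argument gives,
almost surely and simultaneously for a countable dense set of solutions, convergence of the
Θ-distances and decrease → 0. Along such a realization compactness gives ℤ Û^k → 0. Hence successive
differences and delay errors vanish, cluster points are solutions, and an Opial-type argument
through the dense set gives convergence of the whole sequence (`exists_tendsto_solSet`). -/

namespace DYNA

variable {m T : ℕ}

/-! ### Coordinates, the inner product and the exchange of edge endpoints -/

section Coordinates

variable {G : SimpleGraph (Fin m)} [DecidableRel G.Adj]

theorem Omega_mulVec (i : Fin m) (j : G.neighborSet i) (p : Block G T i) :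
    (Omega G i j *ᵥ p : Fin T → ℝ) = fun t => p (j, t) := by
  ext t
  simp [Matrix.mulVec, dotProduct, Omega]

theorem Psi_eq (p : Stack G T) : Psi G p = p := by
  ext i c
  simp [Psi, Omega_mulVec]

theorem sum_OmegaT_mulVec (i : Fin m) (v : G.neighborSet i → Fin T → ℝ) :
    (∑ j : G.neighborSet i, (Omega G i j)ᵀ *ᵥ v j : Block G T i) = fun c => v c.1 c.2 := by
  ext ⟨j, t⟩
  rw [Finset.sum_apply, Finset.sum_eq_single j]
  · simp [Matrix.mulVec, dotProduct, Omega]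
  · intro j' _ hj'
    simp [Matrix.mulVec, dotProduct, Omega, hj'.symm]
  · simp

theorem PsiT_eq (w : Stack G T) : PsiT G w = w := by
  ext i c
  simp only [PsiT, sum_OmegaT_mulVec]

theorem dot_eq (u v : Stack G T) : dot G u v = ∑ i, ∑ c, u i c * v i c := rfl

theorem dot_add_left (u u' v : Stack G T) : dot G (u + u') v = dot G u v + dot G u' v := by
  simp [dot, Finset.sum_add_distrib]

theorem dot_add_right (u v v' : Stack G T) : dot G u (v + v') = dot G u v + dot G u v' := by
  simp [dot, Finset.sum_add_distrib]

theorem dot_sub_right (u v v' : Stack G T) : dot G u (v - v') = dot G u v - dot G u v' := by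
  simp [dot, Finset.sum_sub_distrib]

theorem dot_sub_left (u u' v : Stack G T) : dot G (u - u') v = dot G u v - dot G u' v := by
  simp [dot, Finset.sum_sub_distrib]

theorem dot_smul_right (r : ℝ) (u v : Stack G T) : dot G u (r • v) = r * dot G u v := by
  simp [dot, Finset.mul_sum]

theorem dot_neg_right (u v : Stack G T) : dot G u (-v) = -dot G u v := by
  simp [dot]

theorem dot_neg_left (u v : Stack G T) : dot G (-u) v = -dot G u v := by
  simp [dot]

theorem dot_comm (u v : Stack G T) : dot G u v = dot G v u := by
  simp [dot, dotProduct_comm]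

theorem dot_self_eq_zero {u : Stack G T} (h : dot G u u = 0) : u = 0 := by
  rw [dot_eq, Finset.sum_eq_zero_iff_of_nonneg
    (fun _ _ => Finset.sum_nonneg fun _ _ => mul_self_nonneg _)] at h
  ext i c
  have h1 := h i (Finset.mem_univ i)
  rw [Finset.sum_eq_zero_iff_of_nonneg (fun _ _ => mul_self_nonneg _)] at h1
  simpa using h1 c (Finset.mem_univ c)

/-- The involution exchanging the two values attached to the endpoints of each edge. -/
def flip (p : Stack G T) : Stack G T := fun _ c => p c.1.1 (back c.1, c.2)

theorem flip_flip (p : Stack G T) : flip (flip p) = p := rfl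

theorem flip_add (p q : Stack G T) : flip (p + q) = flip p + flip q := rfl

theorem flip_sub (p q : Stack G T) : flip (p - q) = flip p - flip q := rfl

theorem flip_smul (r : ℝ) (p : Stack G T) : flip (r • p) = r • flip p := rfl

theorem flip_neg (p : Stack G T) : flip (-p) = -flip p := rfl

/-- The permutation of the coordinates underlying `flip`. -/
def flipEquiv (G : SimpleGraph (Fin m)) (T : ℕ) :
    (Σ i : Fin m, G.neighborSet i × Fin T) ≃ Σ i : Fin m, G.neighborSet i × Fin T where
  toFun x := ⟨x.2.1.1, (back x.2.1, x.2.2)⟩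
  invFun x := ⟨x.2.1.1, (back x.2.1, x.2.2)⟩
  left_inv _ := rfl
  right_inv _ := rfl

theorem sum_flip (F : (i : Fin m) → G.neighborSet i × Fin T → ℝ) :
    ∑ i, ∑ c, F i c = ∑ i, ∑ c : G.neighborSet i × Fin T, F c.1.1 (back c.1, c.2) := by
  rw [← Fintype.sum_sigma', ← Fintype.sum_sigma']
  exact ((flipEquiv G T).sum_comp fun x => F x.1 x.2).symm

theorem dot_flip_flip (u v : Stack G T) : dot G (flip u) (flip v) = dot G u v := by
  rw [dot_eq, dot_eq, sum_flip fun i c => u i c * v i c]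
  rfl

theorem dot_flip_right (u v : Stack G T) : dot G u (flip v) = dot G (flip u) v := by
  rw [← dot_flip_flip, flip_flip]

/-- Symmetric and antisymmetric stacks are orthogonal. -/
theorem dot_eq_zero_of_flip {u v : Stack G T} (hu : flip u = u) (hv : flip v = -v) :
    dot G u v = 0 := by
  have := dot_flip_flip u v
  rw [hu, hv, dot_neg_right] at this
  linarith

end Coordinates

/-! ### The weighted inner product and the condition number of the step-sizes -/

section Weights

variable {G : SimpleGraph (Fin m)} [DecidableRel G.Adj] {α : Fin m → ℝ} {β : Sym2 (Fin m) → ℝ}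

/-- The inner product weighted by `Ts`. -/
noncomputable def ipTs (G : SimpleGraph (Fin m)) [DecidableRel G.Adj] (α : Fin m → ℝ)
    (β : Sym2 (Fin m) → ℝ)
    (X Y : State G T) : ℝ := ip G X (Ts G α β Y)

theorem ipTs_eq (X Y : State G T) :
    ipTs G α β X Y = ∑ i, ∑ c : G.neighborSet i × Fin T,
      ((β s(i, c.1.1))⁻¹ * (X.1 i c * Y.1 i c) + (α i)⁻¹ * (X.2 i c * Y.2 i c)) := by
  simp only [ipTs, ip, dot_eq, Ts, LinearMap.coe_mk, AddHom.coe_mk, ← Finset.sum_add_distrib]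
  refine Finset.sum_congr rfl fun i _ => Finset.sum_congr rfl fun c _ => by ring

theorem normSqTs_eq (X : State G T) :
    normSqTs G α β X = ∑ i, ∑ c : G.neighborSet i × Fin T,
      ((β s(i, c.1.1))⁻¹ * X.1 i c ^ 2 + (α i)⁻¹ * X.2 i c ^ 2) := by
  rw [show normSqTs G α β X = ipTs G α β X X from rfl, ipTs_eq]
  refine Finset.sum_congr rfl fun i _ => Finset.sum_congr rfl fun c _ => by ring

theorem normSqTs_smul (r : ℝ) (X : State G T) :
    normSqTs G α β (r • X) = r ^ 2 * normSqTs G α β X := by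
  simp only [normSqTs_eq, Finset.mul_sum, Prod.smul_fst, Prod.smul_snd, Pi.smul_apply, smul_eq_mul]
  refine Finset.sum_congr rfl fun i _ => Finset.sum_congr rfl fun c _ => by ring

theorem normSqTs_neg (X : State G T) : normSqTs G α β (-X) = normSqTs G α β X := by
  simp [normSqTs_eq]

theorem normSqTs_sub (X Y : State G T) : normSqTs G α β (X - Y) =
    normSqTs G α β X - 2 * ipTs G α β X Y + normSqTs G α β Y := by
  simp only [normSqTs_eq, ipTs_eq, Finset.mul_sum, ← Finset.sum_add_distrib,
    ← Finset.sum_sub_distrib, Prod.fst_sub, Prod.snd_sub, Pi.sub_apply]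
  refine Finset.sum_congr rfl fun i _ => Finset.sum_congr rfl fun c _ => by ring

theorem edge_mem {i : Fin m} (j : G.neighborSet i) : s(i, j.1) ∈ G.edgeSet := j.2

variable (hα : ∀ i, 0 < α i) (hβ : ∀ e ∈ G.edgeSet, 0 < β e)
include hα hβ

theorem normSqTs_nonneg (X : State G T) : 0 ≤ normSqTs G α β X := by
  rw [normSqTs_eq]
  refine Finset.sum_nonneg fun i _ => Finset.sum_nonneg fun c _ => ?_
  have := hα i
  have := hβ _ (edge_mem c.1)
  positivity

omit hα hβ in
theorem Ts_fst (X : State G T) (i : Fin m) (c : G.neighborSet i × Fin T) :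
    (Ts G α β X).1 i c = (β s(i, c.1.1))⁻¹ * X.1 i c := rfl

omit hα hβ in
theorem Ts_snd (X : State G T) (i : Fin m) (c : G.neighborSet i × Fin T) :
    (Ts G α β X).2 i c = (α i)⁻¹ * X.2 i c := rfl

theorem hasEigenvalue_Ts_pos {r : ℝ}
    (hr : (Ts G α β : Module.End ℝ (State G T)).HasEigenvalue r) : 0 < r := by
  obtain ⟨v, hv⟩ := hr.exists_hasEigenvector
  have hv1 := hv.apply_eq_smul
  by_contra hneg
  apply hv.2
  have h1 : ∀ i, ∀ c : G.neighborSet i × Fin T, (β s(i, c.1.1))⁻¹ * v.1 i c = r * v.1 i c := by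
    intro i c
    rw [← Ts_fst, hv1]
    rfl
  have h2 : ∀ i, ∀ c : G.neighborSet i × Fin T, (α i)⁻¹ * v.2 i c = r * v.2 i c := by
    intro i c
    rw [← Ts_snd, hv1]
    rfl
  ext i c
  · have hb := inv_pos.2 (hβ _ (edge_mem c.1))
    have : ((β s(i, c.1.1))⁻¹ - r) * v.1 i c = 0 := by linarith [h1 i c]
    exact (mul_eq_zero.1 this).resolve_left (by linarith)
  · have hb := inv_pos.2 (hα i)
    have : ((α i)⁻¹ - r) * v.2 i c = 0 := by linarith [h2 i c]
    exact (mul_eq_zero.1 this).resolve_left (by linarith)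

/-- The extreme eigenvalues are an `sSup` and an `sInf` of real numbers, meaningful only for a
bounded nonempty set. Finite dimension gives finiteness, and a basis vector of a nonempty block
gives the eigenvalue `(α i)⁻¹`. This lower bound is the only property of κ_s that the convergence
proof needs. -/
theorem one_le_kappaS (hne : ∃ i, Nonempty (G.neighborSet i × Fin T)) :
    1 ≤ kappaS G α β T := by
  obtain ⟨i, ⟨c⟩⟩ := hne
  set L : Module.End ℝ (State G T) := Ts G α β
  have hfin : {r | L.HasEigenvalue r}.Finite := L.finite_hasEigenvalue
  have hmem : (α i)⁻¹ ∈ {r | L.HasEigenvalue r} := by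
    classical
    refine Module.End.hasEigenvalue_of_hasEigenvector
      (x := ((0 : Stack G T), (Pi.single i (Pi.single c 1) : Stack G T))) ⟨?_, ?_⟩
    · rw [Module.End.mem_eigenspace_iff]
      refine Prod.ext ?_ ?_
      · ext i' c'
        rw [Ts_fst]
        simp
      · ext i' c'
        rw [Ts_snd]
        by_cases h : i' = i
        · subst h
          rfl
        · simp [Pi.single_eq_of_ne h]
    · intro h
      have := congrFun (congrFun (congrArg Prod.snd h) i) c
      simp at this
  have hmin : 0 < lamMin L := by
    have := Set.Nonempty.csInf_mem ⟨_, hmem⟩ hfin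
    exact hasEigenvalue_Ts_pos hα hβ this
  have hle : lamMin L ≤ lamMax L :=
    (csInf_le hfin.bddBelow hmem).trans (le_csSup hfin.bddAbove hmem)
  rw [kappaS, le_div_iff₀ hmin]
  linarith

end Weights

/-! ### Consequences of the bounds on step-sizes and relaxation factors -/

section StepSizes

variable {G : SimpleGraph (Fin m)} [DecidableRel G.Adj] (M : Market G T)

theorem Market.a_le_Lf (i : Fin m) (c : G.neighborSet i × Fin T) : M.a i c ≤ M.Lf :=
  (le_ciSup (Set.finite_range (M.a i)).bddAbove c).trans
    (le_ciSup (f := fun i => ⨆ c, M.a i c) (Set.finite_range _).bddAbove i)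

theorem Market.mu_le_a (i : Fin m) (c : G.neighborSet i × Fin T) : M.mu ≤ M.a i c :=
  (ciInf_le (f := fun i => ⨅ c, M.a i c) (Set.finite_range _).bddBelow i).trans
    (ciInf_le (Set.finite_range (M.a i)).bddBelow c)

/-- All blocks must be nonempty, because the real infimum over an empty index type is 0. -/
theorem Market.mu_pos (hne : ∀ i, Nonempty (G.neighborSet i × Fin T)) [Nonempty (Fin m)] :
    0 < M.mu := by
  obtain ⟨i, hi⟩ := exists_eq_ciInf_of_finite (f := fun i => ⨅ c, M.a i c)
  have := hne i
  obtain ⟨c, hc⟩ := exists_eq_ciInf_of_finite (f := fun c => M.a i c)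
  rw [Market.mu, ← hi, ← hc]
  exact M.a_pos i c

/-- The matrix is diagonal with entries β, so applying it to a basis vector bounds its operator norm
from below. -/
theorem le_couplingNorm (β : Sym2 (Fin m) → ℝ) (i : Fin m)
    (c : G.neighborSet i × Fin T) : β s(i, c.1.1) ≤ couplingNorm G β T i := by
  classical
  have h1 : ((∑ j : G.neighborSet i, β s(i, j.1) •
      ((Omega G i j)ᵀ * (Omega G i j : Matrix (Fin T) (G.neighborSet i × Fin T) ℝ)) :
      Matrix (G.neighborSet i × Fin T) (G.neighborSet i × Fin T) ℝ)) *ᵥ (Pi.single c 1)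
      = β s(i, c.1.1) • Pi.single c 1 := by
    have h : ∀ j : G.neighborSet i, (β s(i, j.1) •
        ((Omega G i j)ᵀ * (Omega G i j : Matrix (Fin T) (G.neighborSet i × Fin T) ℝ)) :
        Matrix (G.neighborSet i × Fin T) (G.neighborSet i × Fin T) ℝ) *ᵥ (Pi.single c 1)
        = (Omega G i j)ᵀ *ᵥ (β s(i, j.1) • fun t => (Pi.single c 1 : Block G T i) (j, t)) := by
      intro j
      rw [← Omega_mulVec, Matrix.mulVec_smul, Matrix.smul_mulVec]
      exact congrArg _ (Matrix.mulVec_mulVec _ _ _).symm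
    rw [Matrix.sum_mulVec, Finset.sum_congr rfl fun j _ => h j, sum_OmegaT_mulVec (T := T) i
      (fun j => β s(i, j.1) • fun t => (Pi.single c 1 : Block G T i) (j, t))]
    ext c'
    by_cases h : c' = c
    · subst h; simp
    · simp [Pi.single_eq_of_ne h]
  have h2 := (Matrix.toEuclideanCLM (n := G.neighborSet i × Fin T) (𝕜 := ℝ)
    (∑ j : G.neighborSet i, β s(i, j.1) •
      ((Omega G i j)ᵀ * (Omega G i j : Matrix (Fin T) (G.neighborSet i × Fin T) ℝ)))).le_opNorm
    (WithLp.toLp 2 (Pi.single c 1))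
  rw [Matrix.toEuclideanCLM_toLp, h1, WithLp.toLp_smul, norm_smul] at h2
  have h3 : ‖(WithLp.toLp 2 (Pi.single c 1) : EuclideanSpace ℝ (G.neighborSet i × Fin T))‖ = 1 := by
    simp
  rw [h3, mul_one, mul_one] at h2
  exact (le_abs_self _).trans h2

/-- The step-size condition, coordinatewise. -/
theorem Market.inv_alpha_ge {α : Fin m → ℝ} {β : Sym2 (Fin m) → ℝ}
    (hβ : ∀ e ∈ G.edgeSet, 0 < β e)
    (hα : ∀ i, 0 < α i ∧ α i ≤ 1 / (M.kappaF * (M.Lf / 2) + couplingNorm G β T i))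
    (hne : ∀ i, Nonempty (G.neighborSet i × Fin T)) (i : Fin m)
    (c : G.neighborSet i × Fin T) : M.a i c / 2 + β s(i, c.1.1) ≤ (α i)⁻¹ := by
  have : Nonempty (Fin m) := ⟨i⟩
  have hmu := M.mu_pos hne
  -- The factor κ_f only strengthens the condition: as κ_f ≥ 1, the term κ_f L_f / 2 dominates every
  -- a/2.
  have hk : 1 ≤ M.kappaF := by
    rw [Market.kappaF, le_div_iff₀ hmu]
    linarith [M.a_le_Lf i c, M.mu_le_a i c]
  have hL := M.a_le_Lf i c
  have ha := M.a_pos i c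
  have h1 : M.a i c / 2 + β s(i, c.1.1) ≤ M.kappaF * (M.Lf / 2) + couplingNorm G β T i := by
    have := le_couplingNorm β i c
    nlinarith
  have h2 : 0 < M.kappaF * (M.Lf / 2) + couplingNorm G β T i := by
    have := hβ _ (edge_mem c.1)
    linarith
  refine h1.trans ?_
  rw [le_inv_comm₀ h2 (hα i).1, ← one_div]
  exact (hα i).2

end StepSizes

/-- Since θ_i P_i ≤ θ_i P_max, the bound on θ_i gives a lower bound on 1/(θ_i P_i), namely its
denominator divided by P_max. The κ_s/P_min term then matches exactly, and the square-root term has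
room to spare because P_max ≤ 1. -/
theorem varpi_nonneg {G : SimpleGraph (Fin m)} [DecidableRel G.Adj] {α : Fin m → ℝ}
    {β : Sym2 (Fin m) → ℝ} {d : ℕ} {P θ : Fin m → ℝ} (hk : 1 ≤ kappaS G α β T)
    (hP : ∀ i, 0 < P i ∧ P i < 1)
    (hθ : ∀ i, 0 < θ i ∧
      θ i ≤ 1 / (2 * d * √(kappaS G α β T * kappaP P) + kappaS G α β T * kappaP P)) (i : Fin m) :
    0 ≤ varpi G α β T P θ d i := by
  have : Nonempty (Fin m) := ⟨i⟩
  set K := kappaS G α β T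
  have hmin : 0 < Pmin P := by
    obtain ⟨j, hj⟩ := exists_eq_ciInf_of_finite (f := P)
    rw [Pmin, ← hj]
    exact (hP j).1
  have hmax : Pmax P ≤ 1 := ciSup_le fun j => (hP j).2.le
  have hi : P i ≤ Pmax P := le_ciSup (Set.finite_range P).bddAbove i
  have hmax0 : 0 < Pmax P := (hP i).1.trans_le hi
  have hq : 0 < θ i * P i := mul_pos (hθ i).1 (hP i).1
  have hKP : 0 < K * kappaP P := by
    have : 0 < kappaP P := div_pos hmax0 hmin
    positivity
  have hB : 0 < 2 * d * √(K * kappaP P) + K * kappaP P := by positivity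
  have h1 : θ i * P i ≤ Pmax P / (2 * d * √(K * kappaP P) + K * kappaP P) := by
    calc θ i * P i ≤ 1 / (2 * d * √(K * kappaP P) + K * kappaP P) * Pmax P :=
          mul_le_mul (hθ i).2 hi (hP i).1.le (by positivity)
      _ = _ := by ring
  have h2 : (2 * d * √(K * kappaP P) + K * kappaP P) / Pmax P ≤ 1 / (θ i * P i) := by
    rw [le_div_iff₀ hq, ← le_div_iff₀' (by positivity)]
    rwa [one_div_div]
  have h3 : √(K / Pmin P) ≤ √(K * kappaP P) / Pmax P := by
    rw [le_div_iff₀ hmax0]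
    refine Real.le_sqrt_of_sq_le ?_
    rw [mul_pow, Real.sq_sqrt (by positivity), kappaP]
    have : K / Pmin P * Pmax P ^ 2 ≤ K / Pmin P * Pmax P := by
      have : 0 ≤ K / Pmin P := by positivity
      exact mul_le_mul_of_nonneg_left (by nlinarith) this
    calc _ ≤ _ := this
      _ = _ := by ring
  have h4 : K * kappaP P / Pmax P = K / Pmin P := by
    rw [kappaP]
    field_simp
  rw [varpi]
  have h5 : (2 * d * √(K * kappaP P) + K * kappaP P) / Pmax P
      = 2 * d * (√(K * kappaP P) / Pmax P) + K / Pmin P := by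
    rw [← h4]; ring
  have h6 : 2 * d * √(K / Pmin P) ≤ 2 * d * (√(K * kappaP P) / Pmax P) :=
    mul_le_mul_of_nonneg_left h3 (by positivity)
  linarith

end DYNA

/-! ### Euclidean projections and continuity of the operators -/

namespace DYNA

variable {m T : ℕ}

section Projection

variable {ι : Type*} [Fintype ι] {S : Set (ι → ℝ)}

theorem exists_isProj (hS : IsClosed S) (hne : S.Nonempty) (x : ι → ℝ) : ∃ y, IsProj S x y := by
  -- Plain functions carry the sup norm, so distances are minimized in `EuclideanSpace`.
  set S' : Set (EuclideanSpace ℝ ι) := {z | z.ofLp ∈ S} with hS'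
  have hc : IsClosed S' := hS.preimage (PiLp.continuous_ofLp 2 _)
  obtain ⟨z₀, hz₀⟩ := hne
  obtain ⟨y, hy, hd⟩ := hc.exists_infDist_eq_dist ⟨WithLp.toLp 2 z₀, hz₀⟩ (WithLp.toLp 2 x)
  refine ⟨y.ofLp, hy, fun z hz => ?_⟩
  have h1 : dist (WithLp.toLp 2 x) y ≤ dist (WithLp.toLp 2 x) (WithLp.toLp 2 z) := by
    rw [← hd]
    exact Metric.infDist_le_dist_of_mem hz
  rw [EuclideanSpace.dist_eq, EuclideanSpace.dist_eq, Real.sqrt_le_sqrt_iff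
    (Finset.sum_nonneg fun _ _ => sq_nonneg _)] at h1
  simpa [Real.dist_eq, sq_abs] using h1

theorem IsProj.sum_le_zero (hS : Convex ℝ S) {x y : ι → ℝ} (h : IsProj S x y) {z : ι → ℝ}
    (hz : z ∈ S) : ∑ c, (x c - y c) * (z c - y c) ≤ 0 := by
  set I := ∑ c, (x c - y c) * (z c - y c) with hI
  set N := ∑ c, (z c - y c) ^ 2 with hN
  have hN0 : 0 ≤ N := Finset.sum_nonneg fun _ _ => sq_nonneg _
  by_contra! hpos
  -- This t satisfies t N ≤ I, so moving by t towards z changes the squared distance by -2tI + t²N ≤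
  -- -tI < 0, against minimality.
  set t := I / (I + N) with ht
  have hIN : 0 < I + N := by linarith
  have ht0 : 0 < t := div_pos hpos hIN
  have ht1 : t ≤ 1 := by rw [ht, div_le_one hIN]; linarith
  have hmem : y + t • (z - y) ∈ S := hS.add_smul_sub_mem h.1 hz ⟨ht0.le, ht1⟩
  have h1 := h.2 _ hmem
  have h2 : ∑ c, (x c - (y + t • (z - y)) c) ^ 2
      = ∑ c, (x c - y c) ^ 2 - 2 * t * I + t ^ 2 * N := by
    rw [hI, hN, Finset.mul_sum, Finset.mul_sum, ← Finset.sum_sub_distrib,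
      ← Finset.sum_add_distrib]
    refine Finset.sum_congr rfl fun c _ => ?_
    simp only [Pi.add_apply, Pi.smul_apply, Pi.sub_apply, smul_eq_mul]
    ring
  have h3 : t * N ≤ I := by
    rw [ht, div_mul_eq_mul_div, div_le_iff₀ hIN]
    nlinarith
  nlinarith

theorem proj_isProj (hS : IsClosed S) (hne : S.Nonempty) (x : ι → ℝ) : IsProj S x (proj S x) :=
  Classical.epsilon_spec (exists_isProj hS hne x)

theorem sum_sq_proj_sub_le (hS : IsClosed S) (hc : Convex ℝ S) (hne : S.Nonempty)
    (x x' : ι → ℝ) : ∑ c, (proj S x c - proj S x' c) ^ 2 ≤ ∑ c, (x c - x' c) ^ 2 := by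
  have h := proj_isProj hS hne x
  have h' := proj_isProj hS hne x'
  have h1 := h.sum_le_zero hc h'.1
  have h2 := h'.sum_le_zero hc h.1
  have h3 : ∑ c, (proj S x c - proj S x' c) ^ 2 ≤ ∑ c, (x c - x' c) ^ 2
      + 2 * (∑ c, (x c - proj S x c) * (proj S x' c - proj S x c)
      + ∑ c, (x' c - proj S x' c) * (proj S x c - proj S x' c)) := by
    rw [← Finset.sum_add_distrib, Finset.mul_sum, ← Finset.sum_add_distrib]
    refine Finset.sum_le_sum fun c _ => ?_
    nlinarith [sq_nonneg ((x c - x' c) - (proj S x c - proj S x' c))]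
  linarith

theorem continuous_proj (hS : IsClosed S) (hc : Convex ℝ S) (hne : S.Nonempty) :
    Continuous (proj S) := by
  refine continuous_iff_continuousAt.2 fun x => ?_
  refine tendsto_pi_nhds.2 fun c => ?_
  have h1 : Tendsto (fun x' => √(∑ c, (x' c - x c) ^ 2)) (𝓝 x) (𝓝 0) := by
    have : Continuous fun x' : ι → ℝ => √(∑ c, (x' c - x c) ^ 2) := by fun_prop
    simpa using this.tendsto x
  refine tendsto_iff_dist_tendsto_zero.2
    (squeeze_zero (fun _ => dist_nonneg) (fun x' => ?_) h1)
  rw [Real.dist_eq]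
  refine Real.abs_le_sqrt (le_trans ?_ (sum_sq_proj_sub_le hS hc hne x' x))
  exact Finset.single_le_sum (f := fun c => (proj S x' c - proj S x c) ^ 2)
    (fun _ _ => sq_nonneg _) (Finset.mem_univ c)

end Projection

namespace Market

variable {G : SimpleGraph (Fin m)} [DecidableRel G.Adj] (M : Market G T)

theorem isClosed_localSet (i : Fin m) : IsClosed (M.localSet i) := by
  simp only [localSet, Set.ofPred_and, Set.ofPred_forall]
  refine IsClosed.inter ?_ (IsClosed.inter ?_ ?_)
  · exact isClosed_iInter fun t => IsClosed.inter
      (isClosed_le continuous_const (by fun_prop)) (isClosed_le (by fun_prop) continuous_const)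
  · exact isClosed_iInter fun t => isClosed_iInter fun _ => isClosed_iInter fun j =>
      isClosed_le continuous_const (by fun_prop)
  · exact isClosed_iInter fun t => isClosed_iInter fun _ => isClosed_iInter fun j =>
      isClosed_le (by fun_prop) continuous_const

theorem convex_localSet (i : Fin m) : Convex ℝ (M.localSet i) := by
  intro p hp q hq r s hr hs hrs
  have hsum : ∀ t, ∑ j : G.neighborSet i, (r • p + s • q) (j, t)
      = r * ∑ j : G.neighborSet i, p (j, t) + s * ∑ j : G.neighborSet i, q (j, t) := by
    intro t
    simp [Finset.sum_add_distrib, Finset.mul_sum]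
  refine ⟨fun t => ?_, fun t ht j => ?_, fun t ht j => ?_⟩
  · rw [hsum]
    have h1 := hp.1 t
    have h2 := hq.1 t
    have e1 : M.pmin i t = r * M.pmin i t + s * M.pmin i t := by rw [← add_mul, hrs, one_mul]
    have e2 : M.pmax i t = r * M.pmax i t + s * M.pmax i t := by rw [← add_mul, hrs, one_mul]
    constructor
    · rw [e1]
      exact add_le_add (mul_le_mul_of_nonneg_left h1.1 hr) (mul_le_mul_of_nonneg_left h2.1 hs)
    · rw [e2]
      exact add_le_add (mul_le_mul_of_nonneg_left h1.2 hr) (mul_le_mul_of_nonneg_left h2.2 hs)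
  · have h1 := hp.2.1 t ht j
    have h2 := hq.2.1 t ht j
    simp only [Pi.add_apply, Pi.smul_apply, smul_eq_mul]
    positivity
  · have h1 := mul_nonneg hr (neg_nonneg.2 (hp.2.2 t ht j))
    have h2 := mul_nonneg hs (neg_nonneg.2 (hq.2.2 t ht j))
    simp only [Pi.add_apply, Pi.smul_apply, smul_eq_mul]
    linarith

theorem gradF_apply (x : Stack G T) (i : Fin m) (c : G.neighborSet i × Fin T) :
    M.gradF x i c = M.a i c * x i c + M.b i c := by
  simp [gradF, A, Matrix.mulVec_diagonal]

variable (α : Fin m → ℝ) (β : Sym2 (Fin m) → ℝ)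

/-- The intermediate dual variables, stacked. -/
noncomputable def wStack (U : State G T) : Stack G T := fun i c => M.wbar β U i c.1 c.2

/-- The intermediate primal variables, stacked. -/
noncomputable def pStack (U : State G T) : Stack G T := fun i => M.pbar α β U i

theorem wStack_apply (U : State G T) (i : Fin m) (c : G.neighborSet i × Fin T) :
    M.wStack β U i c = β s(i, c.1.1) / 2 * (U.2 i c + flip U.2 i c - M.loss i c)
      + 1 / 2 * (U.1 i c + flip U.1 i c) := by
  simp [wStack, wbar, Omega_mulVec, flip]
  ring

theorem pStack_apply (U : State G T) (i : Fin m) :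
    M.pStack α β U i = proj (M.localSet i) fun c =>
      U.2 i c - α i * (M.gradF U.2 i c + M.wStack β U i c) := by
  simp only [pStack, pbar, sum_OmegaT_mulVec]
  congr 1
  ext c
  simp only [Pi.sub_apply, Pi.smul_apply, smul_eq_mul, gradF, wStack, Pi.add_apply]
  ring

theorem Zop_fst_apply (U : State G T) (i : Fin m) (c : G.neighborSet i × Fin T) :
    (M.Zop α β U).1 i c
      = U.1 i c - M.wStack β U i c - β s(i, c.1.1) * (M.pStack α β U i c - U.2 i c) := by
  simp [Zop, syn, wStack, pStack, Omega_mulVec]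
  ring

theorem Zop_snd_apply (U : State G T) (i : Fin m) (c : G.neighborSet i × Fin T) :
    (M.Zop α β U).2 i c = U.2 i c - M.pStack α β U i c := by
  simp [Zop, syn, pStack]

@[fun_prop]
theorem continuous_flip : Continuous (flip : Stack G T → Stack G T) := by
  refine continuous_pi fun i => continuous_pi fun c => ?_
  unfold flip
  fun_prop

theorem continuous_wStack : Continuous (M.wStack β) := by
  refine continuous_pi fun i => continuous_pi fun c => ?_
  simp only [wStack_apply]
  fun_prop

theorem continuous_gradF : Continuous M.gradF := by
  refine continuous_pi fun i => continuous_pi fun c => ?_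
  simp only [gradF_apply]
  fun_prop

theorem continuous_pStack (hne : ∀ i, (M.localSet i).Nonempty) : Continuous (M.pStack α β) := by
  refine continuous_pi fun i => ?_
  simp only [pStack_apply]
  have h1 := M.continuous_wStack β
  have h2 := M.continuous_gradF
  exact (continuous_proj (M.isClosed_localSet i) (M.convex_localSet i) (hne i)).comp
    (by fun_prop)

theorem continuous_Zop (hne : ∀ i, (M.localSet i).Nonempty) : Continuous (M.Zop α β) := by
  have h1 := M.continuous_wStack β
  have h2 := M.continuous_pStack α β hne
  refine Continuous.prodMk (f := fun U => (M.Zop α β U).1) (g := fun U => (M.Zop α β U).2) ?_ ?_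
  · refine continuous_pi fun i => continuous_pi fun c => ?_
    simp only [Zop_fst_apply]
    fun_prop
  · refine continuous_pi fun i => continuous_pi fun c => ?_
    simp only [Zop_snd_apply]
    fun_prop

end Market

/-- The part of a state owned by agent `i`. -/
def owned {G : SimpleGraph (Fin m)} (i : Fin m) (X : State G T) : State G T :=
  (fun i' c => if i' = i then X.1 i' c else 0, fun i' c => if i' = i then X.2 i' c else 0)

section Owned

variable {G : SimpleGraph (Fin m)} [DecidableRel G.Adj]

@[fun_prop]
theorem continuous_owned (i : Fin m) : Continuous (owned i : State G T → State G T) := by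
  refine Continuous.prodMk ?_ ?_
  · refine continuous_pi fun i' => continuous_pi fun c => ?_
    split_ifs <;> fun_prop
  · refine continuous_pi fun i' => continuous_pi fun c => ?_
    split_ifs <;> fun_prop

theorem Market.asynStep_eq (M : Market G T) (α : Fin m → ℝ) (β : Sym2 (Fin m) → ℝ)
    (θ : Fin m → ℝ) (i : Fin m) (U Uh : State G T) :
    M.asynStep α β θ i U Uh = U - θ i • owned i (M.Zop α β Uh) := by
  refine Prod.ext ?_ ?_
  · ext i' c
    simp only [asynStep, owned, Prod.fst_sub, Prod.smul_fst, Pi.sub_apply, Pi.smul_apply,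
      smul_eq_mul]
    split_ifs with h
    · subst h
      rw [Zop_fst_apply, Omega_mulVec]
      simp only [wStack, pStack, Pi.sub_apply]
      ring
    · simp
  · ext i' c
    simp only [asynStep, owned, Prod.snd_sub, Prod.smul_snd, Pi.sub_apply, Pi.smul_apply,
      smul_eq_mul]
    split_ifs with h
    · subst h
      rw [Zop_snd_apply]
      simp only [pStack]
      ring
    · simp

theorem Market.continuous_asynStep (M : Market G T) (α : Fin m → ℝ) (β : Sym2 (Fin m) → ℝ)
    (hne : ∀ i, (M.localSet i).Nonempty) (θ : Fin m → ℝ) (i : Fin m) :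
    Continuous fun p : State G T × State G T => M.asynStep α β θ i p.1 p.2 := by
  have h := M.continuous_Zop α β hne
  simp only [asynStep_eq]
  fun_prop

end Owned

end DYNA

/-! ### Conjugate, subdifferentials and the optimality conditions -/

namespace DYNA

variable {m T : ℕ}

namespace Market

variable {G : SimpleGraph (Fin m)} [DecidableRel G.Adj] (M : Market G T)

theorem reciprocal_iff (p : Stack G T) : M.Reciprocal p ↔ p + flip p = M.loss := by
  constructor
  · intro h
    ext i ⟨j, t⟩
    exact h i j t
  · intro h i j t
    exact congrFun (congrFun h i) (j, t)

variable {M}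

theorem Reciprocal.flip_sub {p q : Stack G T} (hp : M.Reciprocal p) (hq : M.Reciprocal q) :
    flip (p - q) = -(p - q) := by
  rw [reciprocal_iff] at hp hq
  rw [DYNA.flip_sub, eq_sub_of_add_eq' hp, eq_sub_of_add_eq' hq]
  abel

theorem Reciprocal.add_smul {p h : Stack G T} (hp : M.Reciprocal p) (hh : flip h = -h) (t : ℝ) :
    M.Reciprocal (p + t • h) := by
  rw [reciprocal_iff] at hp ⊢
  rw [flip_add, flip_smul, hh, ← hp, smul_neg]
  abel

theorem dot_eq_of_reciprocal {w p q : Stack G T} (hw : flip w = w) (hp : M.Reciprocal p)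
    (hq : M.Reciprocal q) : dot G w p = dot G w q := by
  have := dot_eq_zero_of_flip hw (hp.flip_sub hq)
  rw [dot_sub_right] at this
  linarith

theorem le_conj (w : Stack G T) {p : Stack G T} (hp : M.Reciprocal p) :
    ((dot G w p : ℝ) : EReal) ≤ conj G M.recipIndic w := by
  refine le_trans (le_of_eq ?_) (le_iSup _ p)
  simp [recipIndic, indic, hp]

/-- Two reciprocal points differ by an antisymmetric stack, so a symmetric w pairs equally with all
of them and the supremum is over a constant. -/
theorem conj_eq {w p : Stack G T} (hw : flip w = w) (hp : M.Reciprocal p) :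
    conj G M.recipIndic w = ((dot G w p : ℝ) : EReal) := by
  refine le_antisymm (iSup_le fun y => ?_) (le_conj w hp)
  by_cases hy : M.Reciprocal y
  · simp [recipIndic, indic, hy, dot_eq_of_reciprocal hw hy hp]
  · simp [recipIndic, indic, hy]

theorem dot_sub_flip_self (w : Stack G T) :
    dot G (w - flip w) (w - flip w) = 2 * dot G w (w - flip w) := by
  have e := dot_flip_flip w w
  rw [dot_sub_left, dot_sub_right, dot_sub_right, e, dot_comm (flip w) w]
  ring

theorem flip_eq_of_conj_ne_top {w p : Stack G T} (hp : M.Reciprocal p)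
    (hw : conj G M.recipIndic w ≠ ⊤) : flip w = w := by
  set h := w - flip w with hh
  have hflip : flip h = -h := by rw [hh, flip_sub, flip_flip]; abel
  have h1 : dot G h h = 2 * dot G w h := dot_sub_flip_self w
  by_contra hne
  have h2 : dot G h h ≠ 0 := fun h0 => hne (sub_eq_zero.1 (dot_self_eq_zero h0)).symm
  have h3 : dot G w h ≠ 0 := fun h0 => h2 (by rw [h1, h0, mul_zero])
  have hbot : conj G M.recipIndic w ≠ ⊥ :=
    ne_bot_of_le_ne_bot (EReal.coe_ne_bot _) (le_conj w hp)
  -- The multiple of the antisymmetric direction h is chosen so that the pairing with w equals the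
  -- supposedly finite supremum plus one.
  have h4 := le_conj w (hp.add_smul hflip
    (((conj G M.recipIndic w).toReal - dot G w p + 1) / dot G w h))
  rw [← EReal.coe_toReal hw hbot, EReal.coe_le_coe_iff, dot_add_right, dot_smul_right,
    div_mul_cancel₀ _ h3, EReal.toReal_coe] at h4
  linarith

theorem mem_subdiff_conj_iff {p : Stack G T} (hp : M.Reciprocal p) (w v : Stack G T) :
    v ∈ subdiff G (conj G M.recipIndic) w ↔ flip w = w ∧ M.Reciprocal v := by
  constructor
  · rintro ⟨h1, h2, h3⟩
    have hw := flip_eq_of_conj_ne_top hp h1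
    refine ⟨hw, ?_⟩
    set r := v - p with hr
    have hs : flip (r + flip r) = r + flip r := by rw [flip_add, flip_flip, add_comm]
    -- The subgradient inequality is tested in the symmetric direction r + flip r, along which the
    -- conjugate is linear. It forces ‖r + flip r‖² ≤ 0, so v differs from p by an antisymmetric
    -- stack.
    have h4 := h3 (w + (r + flip r))
    rw [conj_eq hw hp, conj_eq (by rw [flip_add, hw, hs]) hp, add_sub_cancel_left,
      ← EReal.coe_add, EReal.coe_le_coe_iff, dot_add_left] at h4
    have h5 : dot G (r + flip r) (r + flip r) = 2 * dot G r (r + flip r) := by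
      rw [dot_add_left, ← dot_flip_right, hs]
      ring
    have h6 : dot G r (r + flip r) = dot G v (r + flip r) - dot G (r + flip r) p := by
      rw [dot_comm (r + flip r) p, ← dot_sub_left]
    have h7 : dot G (r + flip r) (r + flip r) = 0 := by
      refine le_antisymm (by linarith) ?_
      rw [dot_eq]
      exact Finset.sum_nonneg fun i _ => Finset.sum_nonneg fun c _ => mul_self_nonneg _
    have h8 := dot_self_eq_zero h7
    rw [reciprocal_iff] at hp ⊢
    rw [← hp, ← sub_eq_zero, ← h8, hr, flip_sub]
    abel
  · rintro ⟨hw, hv⟩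
    refine ⟨?_, ?_, fun y => ?_⟩
    · rw [conj_eq hw hp]; exact EReal.coe_ne_top _
    · rw [conj_eq hw hp]; exact EReal.coe_ne_bot _
    · rw [conj_eq hw hv, ← EReal.coe_add]
      refine le_trans (le_of_eq ?_) (le_conj y hv)
      rw [dot_sub_right, dot_comm v y, dot_comm v w]
      ring_nf

variable (M)

theorem g_of_mem {x : Stack G T} (hx : ∀ i, x i ∈ M.localSet i) : M.g x = 0 :=
  Finset.sum_eq_zero fun i _ => by simp [indic, hx i]

theorem g_of_notMem {x : Stack G T} (hx : ¬ ∀ i, x i ∈ M.localSet i) : M.g x = ⊤ := by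
  classical
  push Not at hx
  obtain ⟨i, hi⟩ := hx
  rw [g, ← Finset.add_sum_erase _ _ (Finset.mem_univ i), indic, if_neg hi]
  refine EReal.top_add_of_ne_bot (ne_bot_of_le_ne_bot EReal.zero_ne_bot
    (Finset.sum_nonneg fun j _ => ?_))
  rw [indic]
  split_ifs <;> simp

theorem mem_subdiff_g_iff (x v : Stack G T) :
    v ∈ subdiff G M.g x ↔ (∀ i, x i ∈ M.localSet i) ∧
      ∀ y : Stack G T, (∀ i, y i ∈ M.localSet i) → dot G v (y - x) ≤ 0 := by
  constructor
  · rintro ⟨h1, -, h3⟩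
    have hx : ∀ i, x i ∈ M.localSet i := by
      by_contra h
      exact h1 (M.g_of_notMem h)
    refine ⟨hx, fun y hy => ?_⟩
    have := h3 y
    rw [M.g_of_mem hx, M.g_of_mem hy, zero_add] at this
    exact_mod_cast this
  · rintro ⟨hx, h⟩
    refine ⟨?_, ?_, fun y => ?_⟩
    · rw [M.g_of_mem hx]; exact EReal.zero_ne_top
    · rw [M.g_of_mem hx]; exact EReal.zero_ne_bot
    · by_cases hy : ∀ i, y i ∈ M.localSet i
      · rw [M.g_of_mem hx, M.g_of_mem hy, zero_add]
        exact_mod_cast h y hy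
      · rw [M.g_of_notMem hy]
        exact le_top

/-- The optimality conditions behind the primal-dual solution set. -/
theorem mem_solSet_iff {p : Stack G T} (hp : M.Reciprocal p) (U : State G T) :
    U ∈ M.solSet ↔ flip U.1 = U.1 ∧ M.Reciprocal U.2 ∧ (∀ i, U.2 i ∈ M.localSet i) ∧
      ∀ y : Stack G T, (∀ i, y i ∈ M.localSet i) → 0 ≤ dot G (U.1 + M.gradF U.2) (y - U.2) := by
  have hneg : ∀ y : Stack G T, dot G (-(U.1 + M.gradF U.2)) (y - U.2) ≤ 0 ↔
      0 ≤ dot G (U.1 + M.gradF U.2) (y - U.2) := fun y => by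
    rw [dot_neg_left, neg_nonpos]
  constructor
  · rintro ⟨Y, ⟨hY1, hY2⟩, h0⟩
    have e1 : Y.1 = U.2 := by
      have := congrArg Prod.fst h0
      simp only [TM, TC, Psi_eq, Prod.fst_add, Prod.fst_zero, add_zero] at this
      exact (sub_eq_zero.1 (by rw [sub_eq_add_neg]; exact this.symm))
    have e2 : Y.2 = -(U.1 + M.gradF U.2) := by
      have := congrArg Prod.snd h0
      simp only [TM, TC, PsiT_eq, Prod.snd_add, Prod.snd_zero] at this
      refine eq_neg_of_add_eq_zero_left ?_
      rw [← add_assoc]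
      exact this.symm
    rw [e1, mem_subdiff_conj_iff hp] at hY1
    rw [e2, mem_subdiff_g_iff] at hY2
    exact ⟨hY1.1, hY1.2, hY2.1, fun y hy => (hneg y).1 (hY2.2 y hy)⟩
  · rintro ⟨h1, h2, h3, h4⟩
    refine ⟨(U.2, -(U.1 + M.gradF U.2)), ⟨(mem_subdiff_conj_iff hp _ _).2 ⟨h1, h2⟩,
      (M.mem_subdiff_g_iff _ _).2 ⟨h3, fun y hy => (hneg y).2 (h4 y hy)⟩⟩, ?_⟩
    refine Prod.ext ?_ ?_
    · simp [TM, TC, Psi_eq]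
    · simp [TM, TC, PsiT_eq]

end Market

end DYNA

/-! ### First-order optimality and existence of a multiplier -/

namespace DYNA

variable {m T : ℕ}

namespace Market

variable {G : SimpleGraph (Fin m)} [DecidableRel G.Adj] (M : Market G T)

theorem cost_eq (p : Stack G T) : M.cost p = ∑ i, ∑ c : G.neighborSet i × Fin T,
    (1 / 2 * M.a i c * p i c ^ 2 + M.b i c * p i c + M.c i c) := by
  rw [cost, Finset.sum_comm]
  refine Finset.sum_congr rfl fun i _ => ?_
  rw [Fintype.sum_prod_type_right]
  refine Finset.sum_congr rfl fun t _ => ?_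
  rw [← Finset.sum_add_distrib, ← Finset.sum_sub_distrib]
  refine Finset.sum_congr rfl fun j _ => ?_
  rw [b]
  ring

theorem cost_add_smul (p v : Stack G T) (t : ℝ) : M.cost (p + t • v) =
    M.cost p + t * dot G (M.gradF p) v
      + t ^ 2 * ∑ i, ∑ c : G.neighborSet i × Fin T, 1 / 2 * M.a i c * v i c ^ 2 := by
  simp only [cost_eq, dot_eq, gradF_apply, Finset.mul_sum, ← Finset.sum_add_distrib]
  refine Finset.sum_congr rfl fun i _ => Finset.sum_congr rfl fun c _ => ?_
  simp only [Pi.add_apply, Pi.smul_apply, smul_eq_mul]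
  ring

variable {M}

theorem Feasible.add_smul_sub {p q : Stack G T} (hp : M.Feasible p) (hq : M.Feasible q) {t : ℝ}
    (ht : t ∈ Set.Icc (0 : ℝ) 1) : M.Feasible (p + t • (q - p)) :=
  ⟨hp.1.add_smul (hq.1.flip_sub hp.1) t, fun i =>
    (M.convex_localSet i).add_smul_sub_mem (hp.2 i) (hq.2 i) ht⟩

/-- First-order optimality. -/
theorem IsSolution.dot_gradF_nonneg {p q : Stack G T} (hp : M.IsSolution p) (hq : M.Feasible q) :
    0 ≤ dot G (M.gradF p) (q - p) := by
  set D := dot G (M.gradF p) (q - p) with hD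
  set N := ∑ i, ∑ c : G.neighborSet i × Fin T, 1 / 2 * M.a i c * (q - p) i c ^ 2 with hN
  have hN0 : 0 ≤ N := Finset.sum_nonneg fun i _ => Finset.sum_nonneg fun c _ => by
    have := M.a_pos i c
    positivity
  by_contra! hneg
  have hpos : 0 < N - D := by linarith
  -- With this t one has D + tN = tD, so the cost would change by t²D < 0.
  set t := -D / (N - D) with ht
  have ht0 : 0 < t := div_pos (by linarith) hpos
  have ht1 : t ≤ 1 := by rw [ht, div_le_one hpos]; linarith
  have h1 := hp.2 _ (hp.1.add_smul_sub hq ⟨ht0.le, ht1⟩)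
  rw [cost_add_smul, ← hD, ← hN] at h1
  have h2 : t * (N - D) = -D := div_mul_cancel₀ _ hpos.ne'
  have h3 : 0 ≤ t * (D + t * N) := by nlinarith
  have h4 := nonneg_of_mul_nonneg_right h3 ht0
  nlinarith

variable (M)

/-- The points satisfying all inequalities strictly. -/
def strictSet : Set (Stack G T) :=
  {p | ∀ i t,
    (M.pmin i t < ∑ j : G.neighborSet i, p i (j, t) ∧
      ∑ j : G.neighborSet i, p i (j, t) < M.pmax i t) ∧
    (i ∈ M.seller t → ∀ j, 0 < p i (j, t)) ∧
    (i ∈ M.buyer t → ∀ j, p i (j, t) < 0)}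

theorem isOpen_strictSet : IsOpen M.strictSet := by
  simp only [strictSet, Set.ofPred_forall, Set.ofPred_and]
  refine isOpen_iInter_of_finite fun i => isOpen_iInter_of_finite fun t =>
    IsOpen.inter (IsOpen.inter (isOpen_lt continuous_const (by fun_prop))
      (isOpen_lt (by fun_prop) continuous_const)) (IsOpen.inter ?_ ?_)
  · exact isOpen_iInter_of_finite fun _ => isOpen_iInter_of_finite fun j =>
      isOpen_lt continuous_const (by fun_prop)
  · exact isOpen_iInter_of_finite fun _ => isOpen_iInter_of_finite fun j =>
      isOpen_lt (by fun_prop) continuous_const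

theorem mem_localSet_of_mem_strictSet {p : Stack G T} (hp : p ∈ M.strictSet) (i : Fin m) :
    p i ∈ M.localSet i :=
  ⟨fun t => ⟨(hp i t).1.1.le, (hp i t).1.2.le⟩, fun t ht j => ((hp i t).2.1 ht j).le,
    fun t ht j => ((hp i t).2.2 ht j).le⟩

/-- Segments from a feasible point to a strictly feasible one are strictly feasible. -/
theorem add_mem_strictSet {p q : Stack G T} (hp : ∀ i, p i ∈ M.localSet i)
    (hq : q ∈ M.strictSet) {r s : ℝ} (hr : 0 ≤ r) (hs : 0 < s) (hrs : r + s = 1) :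
    r • p + s • q ∈ M.strictSet := by
  intro i t
  have hsum : ∑ j : G.neighborSet i, (r • p + s • q) i (j, t)
      = r * ∑ j : G.neighborSet i, p i (j, t) + s * ∑ j : G.neighborSet i, q i (j, t) := by
    simp [Finset.sum_add_distrib, Finset.mul_sum]
  have h1 := (hp i).1 t
  have h2 := (hq i t).1
  have e1 : M.pmin i t = r * M.pmin i t + s * M.pmin i t := by rw [← add_mul, hrs, one_mul]
  have e2 : M.pmax i t = r * M.pmax i t + s * M.pmax i t := by rw [← add_mul, hrs, one_mul]
  refine ⟨⟨?_, ?_⟩, fun ht j => ?_, fun ht j => ?_⟩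
  · rw [hsum, e1]
    exact add_lt_add_of_le_of_lt (mul_le_mul_of_nonneg_left h1.1 hr)
      (mul_lt_mul_of_pos_left h2.1 hs)
  · rw [hsum, e2]
    exact add_lt_add_of_le_of_lt (mul_le_mul_of_nonneg_left h1.2 hr)
      (mul_lt_mul_of_pos_left h2.2 hs)
  · have h3 := mul_nonneg hr ((hp i).2.1 t ht j)
    have h4 := mul_pos hs ((hq i t).2.1 ht j)
    simp only [Pi.add_apply, Pi.smul_apply, smul_eq_mul]
    linarith
  · have h3 := mul_nonneg hr (neg_nonneg.2 ((hp i).2.2 t ht j))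
    have h4 := mul_pos hs (neg_pos.2 ((hq i t).2.2 ht j))
    simp only [Pi.add_apply, Pi.smul_apply, smul_eq_mul]
    linarith

theorem convex_strictSet : Convex ℝ M.strictSet := by
  intro p hp q hq r s hr hs hrs
  rcases hs.eq_or_lt with rfl | hs
  · rw [add_zero] at hrs
    simpa [hrs] using hp
  · exact M.add_mem_strictSet (M.mem_localSet_of_mem_strictSet hp) hq hr hs hrs

/-- Every linear form on stacks is given by a stack. -/
theorem exists_dot_eq (φ : Stack G T →ₗ[ℝ] ℝ) : ∃ w : Stack G T, ∀ z, φ z = dot G w z := by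
  classical
  refine ⟨fun i c => φ (Pi.single i (Pi.single c 1)), fun z => ?_⟩
  have hz : z = ∑ i, ∑ c : G.neighborSet i × Fin T,
      z i c • (Pi.single i (Pi.single c 1) : Stack G T) := by
    ext i c
    simp only [Finset.sum_apply, Pi.smul_apply, smul_eq_mul]
    rw [Finset.sum_eq_single i (fun i' _ hi' => by
      simp [Pi.single_eq_of_ne hi'.symm]) (by simp), Finset.sum_eq_single c (fun c' _ hc' => by
      simp [Pi.single_eq_of_ne hc'.symm]) (by simp)]
    simp
  conv_lhs => rw [hz]
  simp only [map_sum, map_smul, smul_eq_mul, dot_eq]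
  exact Finset.sum_congr rfl fun i _ => Finset.sum_congr rfl fun c _ => mul_comm _ _

/-- Strong duality: a primal solution has a Lagrange multiplier. -/
theorem solSet_nonempty (hsol : ∃ p, M.IsSolution p) (hslater : ∃ p, M.StrictlyFeasible p) :
    M.solSet.Nonempty := by
  obtain ⟨x, hx⟩ := hsol
  obtain ⟨q, hqr, hq⟩ := hslater
  replace hq : q ∈ M.strictSet := hq
  set v := M.gradF x with hv
  -- For the cost linearized at x, O collects the pairs (z, ρ) in which z is a displacement to a
  -- strictly feasible point for the inequalities, taken modulo antisymmetric stacks, and ρ exceeds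
  -- the linearized cost of that displacement. Its point z = 0 corresponds to displacements
  -- preserving reciprocity, so first-order optimality of x keeps 0 out of O.
  set O : Set (Stack G T × ℝ) := ⋃ h : {h : Stack G T // flip h = -h},
    {z | x + (z.1 - h.1) ∈ M.strictSet ∧ dot G v (z.1 - h.1) < z.2} with hO
  have hdot : Continuous fun z : Stack G T => dot G v z := by
    simp only [dot_eq]
    fun_prop
  have hopen : IsOpen O := isOpen_iUnion fun h =>
    (M.isOpen_strictSet.preimage (f := fun z : Stack G T × ℝ => x + (z.1 - h.1))
      (by fun_prop)).inter (isOpen_lt (hdot.comp (by fun_prop)) continuous_snd)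
  have hmemO : ∀ z ρ h, flip h = -h → x + (z - h) ∈ M.strictSet → dot G v (z - h) < ρ →
      (z, ρ) ∈ O := fun z ρ h h1 h2 h3 => Set.mem_iUnion.2 ⟨⟨h, h1⟩, h2, h3⟩
  have hconv : Convex ℝ O := by
    intro z hz z' hz' r s hr hs hrs
    obtain ⟨⟨h, hh⟩, h1, h2⟩ := Set.mem_iUnion.1 hz
    obtain ⟨⟨h', hh'⟩, h1', h2'⟩ := Set.mem_iUnion.1 hz'
    have e : (r • z.1 + s • z'.1) - (r • h + s • h') = r • (z.1 - h) + s • (z'.1 - h') := by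
      simp only [smul_sub]
      abel
    refine hmemO _ _ (r • h + s • h') ?_ ?_ ?_
    · rw [flip_add, flip_smul, flip_smul, hh, hh']
      simp only [smul_neg]
      abel
    · have := M.convex_strictSet h1 h1' hr hs hrs
      convert this using 1
      simp only [smul_add, Prod.smul_fst, e]
      rw [show r • x + r • (z.1 - h) + (s • x + s • (z'.1 - h'))
        = (r + s) • x + (r • (z.1 - h) + s • (z'.1 - h')) by rw [add_smul]; abel, hrs, one_smul]
    · simp only [Prod.smul_fst, Prod.smul_snd, smul_eq_mul, e]
      rw [dot_add_right, dot_smul_right, dot_smul_right]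
      rcases hr.eq_or_lt with rfl | hr
      · rw [zero_add] at hrs
        simpa [hrs] using h2'
      · exact add_lt_add_of_lt_of_le (mul_lt_mul_of_pos_left h2 hr)
          (mul_le_mul_of_nonneg_left h2'.le hs)
  have h0 : (0 : Stack G T × ℝ) ∉ O := by
    intro h0
    obtain ⟨⟨h, hh⟩, h1, h2⟩ := Set.mem_iUnion.1 h0
    simp only [Prod.fst_zero, zero_sub, Prod.snd_zero] at h1 h2
    have hf : M.Feasible (x + -h) := by
      refine ⟨?_, M.mem_localSet_of_mem_strictSet h1⟩
      have := hx.1.1.add_smul (h := -h) (by rw [flip_neg, hh]) 1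
      rwa [one_smul] at this
    have := hx.dot_gradF_nonneg hf
    rw [add_sub_cancel_left] at this
    exact absurd h2 (not_lt.2 this)
  obtain ⟨f, hf⟩ := geometric_hahn_banach_point_open hconv hopen h0
  rw [map_zero] at hf
  obtain ⟨w, hw⟩ := exists_dot_eq (f.toLinearMap ∘ₗ LinearMap.inl ℝ (Stack G T) ℝ)
  set lam := f (0, 1) with hlam
  have hfz : ∀ z ρ, f (z, ρ) = dot G w z + ρ * lam := by
    intro z ρ
    rw [← hw, hlam, ← smul_eq_mul, ← map_smul]
    simp only [LinearMap.comp_apply, LinearMap.inl_apply, ContinuousLinearMap.coe_coe]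
    rw [← map_add]
    simp
  have hqx : flip (q - x) = -(q - x) := hqr.flip_sub hx.1.1
  -- Since q - x is antisymmetric, h = (q - x) + (h - (q - x)) lies over the Slater point q for
  -- every antisymmetric h. Taking h = 0 gives a positive cost multiplier, and scaling h forces w to
  -- vanish on antisymmetric stacks.
  have hanti : ∀ h ρ, flip h = -h → dot G v (q - x) < ρ → 0 < dot G w h + ρ * lam := by
    intro h ρ hh hρ
    rw [← hfz]
    refine hf _ (hmemO _ _ (h - (q - x)) ?_ ?_ ?_)
    · rw [flip_sub, hh, hqx]; abel
    · simpa using hq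
    · simpa using hρ
  have hlam0 : 0 < lam := by
    have := hanti 0 (|dot G v (q - x)| + 1) (by rw [neg_zero]; rfl)
      (by linarith [le_abs_self (dot G v (q - x))])
    rw [show dot G w 0 = 0 by simp [dot], zero_add] at this
    exact pos_of_mul_pos_right this (by positivity)
  have hwflip : flip w = w := by
    by_contra hne
    set h := w - flip w with hh
    have hh' : flip h = -h := by rw [hh, flip_sub, flip_flip]; abel
    have h1 : dot G h h = 2 * dot G w h := dot_sub_flip_self w
    have h2 : dot G w h ≠ 0 := fun h0 =>
      hne (sub_eq_zero.1 (dot_self_eq_zero (by rw [h1, h0, mul_zero]))).symm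
    -- The scaling makes the pairing with w cancel ρ λ exactly, contradicting strict positivity.
    have h3 := hanti ((-((dot G v (q - x) + 1) * lam) / dot G w h) • h)
      (dot G v (q - x) + 1) (by rw [flip_smul, hh', smul_neg]) (by linarith)
    rw [dot_smul_right, div_mul_cancel₀ _ h2] at h3
    linarith
  have hstrict : ∀ y ∈ M.strictSet, 0 ≤ dot G w (y - x) + lam * dot G v (y - x) := by
    intro y hy
    have h1 : ∀ ε : ℝ, 0 < ε → 0 ≤ dot G w (y - x) + lam * dot G v (y - x) + ε := by
      intro ε hε
      have := hf _ (hmemO (y - x) (dot G v (y - x) + ε / lam) 0 (by rw [neg_zero]; rfl)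
        (by simpa using hy) (by simpa using div_pos hε hlam0))
      rw [hfz, add_mul, div_mul_cancel₀ _ hlam0.ne'] at this
      linarith
    exact le_of_forall_pos_le_add h1
  refine ⟨(lam⁻¹ • w, x), (M.mem_solSet_iff hqr _).2 ⟨?_, hx.1.1, hx.1.2, fun y hy => ?_⟩⟩
  · simp only [flip_smul, hwflip]
  · set A := dot G w (y - x) + lam * dot G v (y - x) with hA
    set B := dot G w (q - x) + lam * dot G v (q - x) with hB
    -- Separation speaks only of strictly feasible points. A point y of the product of the S_i is
    -- reached by mixing in a little of q and letting its share s tend to 0.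
    have hAB : ∀ s : ℝ, 0 < s → s ≤ 1 → 0 ≤ (1 - s) * A + s * B := by
      intro s hs hs1
      have := hstrict _ (M.add_mem_strictSet hy hq (r := 1 - s) (by linarith) hs (by ring))
      rw [show (1 - s) • y + s • q - x = (1 - s) • (y - x) + s • (q - x) by
        simp only [smul_sub, sub_smul, one_smul]; abel] at this
      simp only [dot_add_right, dot_smul_right] at this
      rw [hA, hB]
      linarith
    have hA0 : 0 ≤ A := by
      by_contra! hneg
      have hB0 : 0 ≤ B := by simpa using hAB 1 one_pos le_rfl
      have hpos : 0 < B - A := by linarith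
      -- At this s the mixture A + s(B - A) equals A/2, which is negative.
      have h1 := hAB (-A / (2 * (B - A))) (div_pos (by linarith) (by linarith))
        (by rw [div_le_one (by linarith)]; linarith)
      have h2 : -A / (2 * (B - A)) * (B - A) = -A / 2 := by field_simp
      nlinarith
    have : dot G (lam⁻¹ • w + v) (y - x) = lam⁻¹ * A := by
      rw [dot_add_left, dot_comm, dot_smul_right, dot_comm, hA, mul_add, ← mul_assoc,
        inv_mul_cancel₀ hlam0.ne', one_mul]
    simp only
    rw [← hv, this]
    exact mul_nonneg (inv_nonneg.2 hlam0.le) hA0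

end Market

end DYNA

/-! ### The synchronous operator brings the state closer to every solution -/

namespace DYNA

variable {m T : ℕ}

namespace Market

variable {G : SimpleGraph (Fin m)} [DecidableRel G.Adj] (M : Market G T)
  {α : Fin m → ℝ} {β : Sym2 (Fin m) → ℝ}

theorem flip_loss {p : Stack G T} (hp : M.Reciprocal p) : flip M.loss = M.loss := by
  rw [← (M.reciprocal_iff p).1 hp, flip_add, flip_flip, add_comm]

theorem flip_wStack {p : Stack G T} (hp : M.Reciprocal p) (U : State G T) :
    flip (M.wStack β U) = M.wStack β U := by
  ext i c
  have h := congrFun (congrFun (M.flip_loss hp) i) c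
  rw [wStack_apply, ← h]
  simp only [flip, wStack_apply, Sym2.eq_swap (a := c.1.1) (b := i), back]
  ring

/-- This is the resolvent relation of the dual update: adding the two ends of an edge turns the
definition of w̄ into the reciprocity equation. The stack is thus a subgradient of the conjugate at
w̄. -/
theorem reciprocal_wStack (hβ : ∀ e ∈ G.edgeSet, 0 < β e) {p : Stack G T} (hp : M.Reciprocal p)
    (U : State G T) :
    M.Reciprocal fun i c => (β s(i, c.1.1))⁻¹ * (U.1 i c - M.wStack β U i c) + U.2 i c := by
  rw [reciprocal_iff]
  ext i c
  have hb := (hβ _ (edge_mem c.1)).ne'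
  have h1 : M.wStack β U c.1.1 (back c.1, c.2) = M.wStack β U i c :=
    congrFun (congrFun (M.flip_wStack hp U) i) c
  have h2 := M.wStack_apply β U i c
  have e : β s(c.1.1, i) = β s(i, c.1.1) := by rw [Sym2.eq_swap]
  simp only [flip] at h2
  simp only [Pi.add_apply, flip, back] at h1 ⊢
  simp only [back] at h2
  rw [e, h1, h2]
  field_simp
  ring

theorem pStack_mem (hne : ∀ i, (M.localSet i).Nonempty) (U : State G T) (i : Fin m) :
    M.pStack α β U i ∈ M.localSet i := by
  rw [pStack_apply]
  exact (proj_isProj (M.isClosed_localSet i) (hne i) _).1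

/-- The variational inequality characterizing the primal update. -/
theorem pStack_variational (hα : ∀ i, 0 < α i) (hne : ∀ i, (M.localSet i).Nonempty)
    (U : State G T) {y : Stack G T} (hy : ∀ i, y i ∈ M.localSet i) :
    ∑ i, ∑ c : G.neighborSet i × Fin T, ((α i)⁻¹ * (U.2 i c - M.pStack α β U i c)
      - M.gradF U.2 i c - M.wStack β U i c) * (y i c - M.pStack α β U i c) ≤ 0 := by
  refine Finset.sum_nonpos fun i _ => ?_
  have h := (proj_isProj (M.isClosed_localSet i) (hne i) fun c =>
      U.2 i c - α i * (M.gradF U.2 i c + M.wStack β U i c)).sum_le_zero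
    (M.convex_localSet i) (hy i)
  rw [← pStack_apply] at h
  have h2 := mul_nonpos_of_nonneg_of_nonpos (inv_nonneg.2 (hα i).le) h
  rw [Finset.mul_sum] at h2
  refine le_trans (le_of_eq ?_) h2
  refine Finset.sum_congr rfl fun c _ => ?_
  have := (hα i).ne'
  field_simp
  ring

variable (α β) in
/-- The decrease of the squared distance to `Us` under a full step of the synchronous operator. -/
noncomputable def decrease (U Us : State G T) : ℝ :=
  2 * ipTs G α β (U - Us) (M.Zop α β U) - normSqTs G α β (M.Zop α β U)

theorem continuous_decrease (hne : ∀ i, (M.localSet i).Nonempty) (Us : State G T) :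
    Continuous fun U => M.decrease α β U Us := by
  have h := M.continuous_Zop α β hne
  simp only [decrease]
  generalize M.Zop α β = Z at h ⊢
  simp only [ipTs_eq, normSqTs_eq]
  fun_prop

variable (hβ : ∀ e ∈ G.edgeSet, 0 < β e) (hα : ∀ i, 0 < α i)
  (hstep : ∀ i, ∀ c : G.neighborSet i × Fin T, M.a i c / 2 + β s(i, c.1.1) ≤ (α i)⁻¹)
include hβ hα

/-- The nonnegative remainders making up `decrease`. -/
theorem decrease_eq {Us : State G T} (hUs : Us ∈ M.solSet) {p : Stack G T} (hp : M.Reciprocal p)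
    (U : State G T) :
    M.decrease α β U Us = (∑ i, ∑ c : G.neighborSet i × Fin T,
      ((β s(i, c.1.1))⁻¹ * (U.1 i c - M.wStack β U i c) ^ 2
        + ((α i)⁻¹ - β s(i, c.1.1) - M.a i c / 2) * (U.2 i c - M.pStack α β U i c) ^ 2
        + 2 * M.a i c * ((U.2 i c - Us.2 i c) - (U.2 i c - M.pStack α β U i c) / 2) ^ 2))
      + 2 * ∑ i, ∑ c : G.neighborSet i × Fin T, ((α i)⁻¹ * (U.2 i c - M.pStack α β U i c)
        - M.a i c * (U.2 i c - Us.2 i c) - (M.wStack β U i c - Us.1 i c))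
        * (M.pStack α β U i c - Us.2 i c) := by
  obtain ⟨h1, h2, -, -⟩ := (M.mem_solSet_iff hp Us).1 hUs
  -- The dual monotonicity term is exactly zero: w̄ - w* is symmetric, and the difference of two
  -- reciprocal points is antisymmetric. Twice this zero accounts for the discrepancy in the
  -- coordinatewise identity below.
  have h3 : dot G (M.wStack β U - Us.1) ((fun i c => (β s(i, c.1.1))⁻¹ *
      (U.1 i c - M.wStack β U i c) + U.2 i c) - Us.2) = 0 := by
    refine dot_eq_zero_of_flip ?_ ((M.reciprocal_wStack hβ hp U).flip_sub h2)
    rw [flip_sub, M.flip_wStack hp, h1]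
  rw [dot_eq] at h3
  rw [← sub_eq_zero, ← mul_zero (2 : ℝ), ← h3]
  simp only [decrease, ipTs_eq, normSqTs_eq, Finset.mul_sum, ← Finset.sum_add_distrib,
    ← Finset.sum_sub_distrib, Zop_fst_apply, Zop_snd_apply, Prod.fst_sub, Prod.snd_sub,
    Pi.sub_apply]
  refine Finset.sum_congr rfl fun i _ => Finset.sum_congr rfl fun c _ => ?_
  have hb := (hβ _ (edge_mem c.1)).ne'
  have ha := (hα i).ne'
  field_simp
  ring

/-- Two variational inequalities are added: that of the projection, tested at x*, and that of the
solution, tested at x̄. -/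
theorem monotone_nonneg (hne : ∀ i, (M.localSet i).Nonempty) {Us : State G T}
    (hUs : Us ∈ M.solSet) {p : Stack G T} (hp : M.Reciprocal p) (U : State G T) :
    0 ≤ ∑ i, ∑ c : G.neighborSet i × Fin T, ((α i)⁻¹ * (U.2 i c - M.pStack α β U i c)
        - M.a i c * (U.2 i c - Us.2 i c) - (M.wStack β U i c - Us.1 i c))
        * (M.pStack α β U i c - Us.2 i c) := by
  obtain ⟨-, -, h3, h4⟩ := (M.mem_solSet_iff hp Us).1 hUs
  have h5 := M.pStack_variational hα hne (β := β) U h3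
  have h6 := h4 (M.pStack α β U) fun i => M.pStack_mem hne U i
  rw [dot_eq] at h6
  have h7 := sub_nonneg.2 (h5.trans h6)
  refine h7.trans (le_of_eq ?_)
  simp only [← Finset.sum_sub_distrib, gradF_apply, Pi.add_apply, Pi.sub_apply]
  refine Finset.sum_congr rfl fun i _ => Finset.sum_congr rfl fun c _ => ?_
  ring

include hstep

omit hα in
theorem remainder_nonneg (U Us : State G T) (i : Fin m) (c : G.neighborSet i × Fin T) :
    0 ≤ (β s(i, c.1.1))⁻¹ * (U.1 i c - M.wStack β U i c) ^ 2
        + ((α i)⁻¹ - β s(i, c.1.1) - M.a i c / 2) * (U.2 i c - M.pStack α β U i c) ^ 2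
        + 2 * M.a i c * ((U.2 i c - Us.2 i c) - (U.2 i c - M.pStack α β U i c) / 2) ^ 2 := by
  have h1 := hβ _ (edge_mem c.1)
  have h2 : 0 ≤ (α i)⁻¹ - β s(i, c.1.1) - M.a i c / 2 := by linarith [hstep i c]
  have h3 := M.a_pos i c
  positivity

theorem decrease_nonneg (hne : ∀ i, (M.localSet i).Nonempty) {Us : State G T}
    (hUs : Us ∈ M.solSet) {p : Stack G T} (hp : M.Reciprocal p) (U : State G T) :
    0 ≤ M.decrease α β U Us := by
  rw [M.decrease_eq hβ hα hUs hp]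
  have h1 := M.monotone_nonneg hβ hα hne hUs hp U
  have h2 := Finset.sum_nonneg fun i (_ : i ∈ Finset.univ) => Finset.sum_nonneg
    fun c (_ : c ∈ Finset.univ) => M.remainder_nonneg hβ hstep U Us i c
  linarith

/-- The decrease is strict away from the primal-dual solutions. -/
theorem mem_solSet_of_decrease_eq_zero (hne : ∀ i, (M.localSet i).Nonempty) {Us : State G T}
    (hUs : Us ∈ M.solSet) {p : Stack G T} (hp : M.Reciprocal p) {U : State G T}
    (h0 : M.decrease α β U Us = 0) : U ∈ M.solSet ∧ M.Zop α β U = 0 := by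
  rw [M.decrease_eq hβ hα hUs hp] at h0
  have h1 := M.monotone_nonneg hβ hα hne hUs hp U
  have hr := M.remainder_nonneg hβ hstep U Us
  have h2 := Finset.sum_nonneg fun i (_ : i ∈ Finset.univ) => Finset.sum_nonneg
    fun c (_ : c ∈ Finset.univ) => hr i c
  have h3 := (Finset.sum_eq_zero_iff_of_nonneg fun i _ => Finset.sum_nonneg fun c _ =>
    hr i c).1 (le_antisymm (by linarith) h2)
  -- The middle remainder may have weight zero when the step-size bound is attained, so x̄ = x
  -- cannot be read off from it. The last remainder only says that x̄ is the reflection of x in x*.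
  have h4 : ∀ i, ∀ c : G.neighborSet i × Fin T, U.1 i c = M.wStack β U i c ∧
      U.2 i c - M.pStack α β U i c = 2 * (U.2 i c - Us.2 i c) := by
    intro i c
    have h5 := (Finset.sum_eq_zero_iff_of_nonneg fun c _ => hr i c).1 (h3 i (Finset.mem_univ i))
      c (Finset.mem_univ c)
    have hb := hβ _ (edge_mem c.1)
    have ha := M.a_pos i c
    have e1 : 0 ≤ (β s(i, c.1.1))⁻¹ * (U.1 i c - M.wStack β U i c) ^ 2 := by positivity
    have e2 : 0 ≤ ((α i)⁻¹ - β s(i, c.1.1) - M.a i c / 2)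
        * (U.2 i c - M.pStack α β U i c) ^ 2 :=
      mul_nonneg (by linarith [hstep i c]) (sq_nonneg _)
    have e3 : 0 ≤ 2 * M.a i c
        * ((U.2 i c - Us.2 i c) - (U.2 i c - M.pStack α β U i c) / 2) ^ 2 := by positivity
    constructor
    · have := (mul_eq_zero.1 (le_antisymm (by linarith) e1)).resolve_left (inv_pos.2 hb).ne'
      exact sub_eq_zero.1 (pow_eq_zero_iff two_ne_zero |>.1 this)
    · have := (mul_eq_zero.1 (le_antisymm (by linarith) e3)).resolve_left (by positivity)
      have := pow_eq_zero_iff two_ne_zero |>.1 this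
      linarith
  have hw : M.wStack β U = U.1 := by
    ext i c
    exact (h4 i c).1.symm
  have hwf : flip U.1 = U.1 := by rw [← hw, M.flip_wStack hp]
  have hx : M.Reciprocal U.2 := by
    have := M.reciprocal_wStack hβ hp U
    simpa [hw] using this
  obtain ⟨g1, g2, -, -⟩ := (M.mem_solSet_iff hp Us).1 hUs
  have h6 : dot G (U.1 - Us.1) (U.2 - Us.2) = 0 :=
    dot_eq_zero_of_flip (by rw [flip_sub, hwf, g1]) (hx.flip_sub g2)
  -- Substituting the reflection into the vanishing monotonicity term leaves the weights 2/α - a ≥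
  -- 2β > 0 on (x - x*)². The cross term with w - w* is an inner product of a symmetric and an
  -- antisymmetric stack. Hence x = x*, and then x̄ = x.
  have h7 : ∑ i, ∑ c : G.neighborSet i × Fin T,
      (2 * (α i)⁻¹ - M.a i c) * (U.2 i c - Us.2 i c) ^ 2 = 0 := by
    have h8 := (by linarith : ∑ i, ∑ c : G.neighborSet i × Fin T,
        ((α i)⁻¹ * (U.2 i c - M.pStack α β U i c)
        - M.a i c * (U.2 i c - Us.2 i c) - (M.wStack β U i c - Us.1 i c))
        * (M.pStack α β U i c - Us.2 i c) = 0)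
    rw [dot_eq] at h6
    rw [← sub_self (0 : ℝ)]
    nth_rewrite 1 [← h6]
    rw [← h8]
    simp only [← Finset.sum_sub_distrib]
    refine Finset.sum_congr rfl fun i _ => Finset.sum_congr rfl fun c _ => ?_
    have e := (h4 i c).2
    rw [show M.pStack α β U i c = U.2 i c - 2 * (U.2 i c - Us.2 i c) by linarith, hw]
    simp only [Pi.sub_apply]
    ring
  have hco : ∀ i, ∀ c : G.neighborSet i × Fin T, 0 < 2 * (α i)⁻¹ - M.a i c := by
    intro i c
    have := hβ _ (edge_mem c.1)
    linarith [hstep i c]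
  have hu : ∀ i, ∀ c : G.neighborSet i × Fin T, U.2 i c - Us.2 i c = 0 := by
    intro i c
    have hnn : ∀ i, ∀ c : G.neighborSet i × Fin T,
        0 ≤ (2 * (α i)⁻¹ - M.a i c) * (U.2 i c - Us.2 i c) ^ 2 := fun i c =>
      mul_nonneg (hco i c).le (sq_nonneg _)
    have e1 := (Finset.sum_eq_zero_iff_of_nonneg fun i _ => Finset.sum_nonneg fun c _ =>
      hnn i c).1 h7 i (Finset.mem_univ i)
    have e2 := (Finset.sum_eq_zero_iff_of_nonneg fun c _ => hnn i c).1 e1 c (Finset.mem_univ c)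
    exact pow_eq_zero_iff two_ne_zero |>.1 ((mul_eq_zero.1 e2).resolve_left (hco i c).ne')
  have hpb : M.pStack α β U = U.2 := by
    ext i c
    have := (h4 i c).2
    rw [hu i c] at this
    linarith
  refine ⟨(M.mem_solSet_iff hp U).2 ⟨hwf, hx, fun i => ?_, fun y hy => ?_⟩, ?_⟩
  · rw [← hpb]
    exact M.pStack_mem hne U i
  · have h9 := M.pStack_variational hα hne (β := β) U hy
    rw [hpb, hw] at h9
    rw [← neg_nonpos, ← dot_neg_left, dot_eq]
    refine le_trans (le_of_eq ?_) h9
    refine Finset.sum_congr rfl fun i _ => Finset.sum_congr rfl fun c _ => ?_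
    simp only [Pi.neg_apply, Pi.add_apply, Pi.sub_apply]
    ring
  · refine Prod.ext ?_ ?_
    · ext i c
      rw [Zop_fst_apply, hw, hpb]
      simp
    · ext i c
      rw [Zop_snd_apply, hpb]
      simp

end Market

end DYNA

/-! ### The Θ-norm as a distance plus weighted past increments -/

namespace DYNA

variable {m T d : ℕ}

section Theta

variable {G : SimpleGraph (Fin m)} [DecidableRel G.Adj] {α : Fin m → ℝ} {β : Sym2 (Fin m) → ℝ}

theorem ipTs_comm (X Y : State G T) : ipTs G α β X Y = ipTs G α β Y X := by
  simp only [ipTs_eq, mul_comm]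

theorem ipTs_add_right (X Y Z : State G T) :
    ipTs G α β X (Y + Z) = ipTs G α β X Y + ipTs G α β X Z := by
  simp only [ipTs_eq, ← Finset.sum_add_distrib, Prod.fst_add, Prod.snd_add, Pi.add_apply]
  refine Finset.sum_congr rfl fun i _ => Finset.sum_congr rfl fun c _ => by ring

theorem ipTs_sub_right (X Y Z : State G T) :
    ipTs G α β X (Y - Z) = ipTs G α β X Y - ipTs G α β X Z := by
  simp only [ipTs_eq, ← Finset.sum_sub_distrib, Prod.fst_sub, Prod.snd_sub, Pi.sub_apply]
  refine Finset.sum_congr rfl fun i _ => Finset.sum_congr rfl fun c _ => by ring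

theorem ipTs_smul_right (r : ℝ) (X Y : State G T) :
    ipTs G α β X (r • Y) = r * ipTs G α β X Y := by
  simp only [ipTs_eq, Finset.mul_sum, Prod.smul_fst, Prod.smul_snd, Pi.smul_apply, smul_eq_mul]
  refine Finset.sum_congr rfl fun i _ => Finset.sum_congr rfl fun c _ => by ring

/-- The block tridiagonal operator Θ is the quadratic form of a weighted sum of squared increments,
recovered by summation by parts. Indexing by ℕ avoids cyclic arithmetic in `Fin (d + 1)`. -/
theorem normSqTheta_eq (P : Fin m → ℝ) (y : ℕ → State G T) :
    normSqTheta G α β P d (fun l => y l) = normSqTs G α β (y 0)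
      + √(Pmin P / kappaS G α β T) *
        ∑ l ∈ Finset.range d, ((d : ℝ) - l) * normSqTs G α β (y l - y (l + 1)) := by
  set s := √(Pmin P / kappaS G α β T) with hs
  rcases d with _ | d
  · simp [normSqTheta, Theta, normSqTs]
  have hzero : ip G (y 0) (Theta G α β P (d + 1) (fun l => y l) 0) = ipTs G α β (y 0) (y 0)
      + (d + 1) * s * (ipTs G α β (y 0) (y 0) - ipTs G α β (y 0) (y 1)) := by
    have : Theta G α β P (d + 1) (fun l => y l) 0
        = Ts G α β (y 0 + (((d + 1 : ℕ) : ℝ) * s) • (y 0 - y 1)) := by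
      simp [Theta, hs]
    rw [this]
    change ipTs G α β _ _ = _
    rw [ipTs_add_right, ipTs_smul_right, ipTs_sub_right]
    push_cast
    ring
  -- One formula covers the interior rows and the last one, because in the last row the coefficient
  -- of `y (l + 2)` is zero.
  have hsucc : ∀ l : Fin (d + 1), ip G (y (l + 1)) (Theta G α β P (d + 1) (fun l => y l) l.succ)
      = s * (-((d : ℝ) + 1 - l) * ipTs G α β (y l) (y (l + 1))
        + (2 * ((d : ℝ) + 1 - l) - 1) * ipTs G α β (y (l + 1)) (y (l + 1))
        - ((d : ℝ) + 1 - l - 1) * ipTs G α β (y (l + 1)) (y (l + 2))) := by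
    intro l
    have hsub : ((l.succ - 1 : Fin (d + 2)) : ℕ) = l := by
      rw [Fin.val_sub_one_of_ne_zero (Fin.succ_ne_zero l)]
      simp
    by_cases hl : l.succ = Fin.last (d + 1)
    · have hld : (l : ℕ) = d := by simpa using congrArg Fin.val hl
      have : Theta G α β P (d + 1) (fun l => y l) l.succ
          = s • Ts G α β (y (l + 1) - y l) := by
        rw [Theta, if_neg (Fin.succ_ne_zero l), if_pos hl, hsub]
        simp [hs]
      rw [this, ← map_smul]
      change ipTs G α β _ _ = _
      rw [ipTs_smul_right, ipTs_sub_right, ipTs_comm (y (l + 1)) (y l), hld]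
      ring
    · have hadd : ((l.succ + 1 : Fin (d + 2)) : ℕ) = l + 2 := by
        rw [Fin.val_add_one, if_neg hl]
        simp
      have : Theta G α β P (d + 1) (fun l => y l) l.succ
          = s • Ts G α β ((((l + 1 : ℕ) : ℝ) - ((d + 1 : ℕ) : ℝ) - 1) • y l
            + (2 * ((d + 1 : ℕ) : ℝ) - 2 * ((l + 1 : ℕ) : ℝ) + 1) • y (l + 1)
            + (((l + 1 : ℕ) : ℝ) - ((d + 1 : ℕ) : ℝ)) • y (l + 2)) := by
        rw [Theta, if_neg (Fin.succ_ne_zero l), if_neg hl, hsub, hadd]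
        simp [hs]
      rw [this, ← map_smul]
      change ipTs G α β _ _ = _
      rw [ipTs_smul_right, ipTs_add_right, ipTs_add_right, ipTs_smul_right, ipTs_smul_right,
        ipTs_smul_right, ipTs_comm (y (l + 1)) (y l)]
      push_cast
      ring
  rw [normSqTheta, Fin.sum_univ_succ]
  simp only [Fin.val_zero, Fin.val_succ]
  rw [hzero, Finset.sum_congr rfl fun l _ => hsucc l, Fin.sum_univ_eq_sum_range (fun l : ℕ =>
    s * (-((d : ℝ) + 1 - l) * ipTs G α β (y l) (y (l + 1))
        + (2 * ((d : ℝ) + 1 - l) - 1) * ipTs G α β (y (l + 1)) (y (l + 1))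
        - ((d : ℝ) + 1 - l - 1) * ipTs G α β (y (l + 1)) (y (l + 2)))) (d + 1)]
  -- The telescoping quantity has weight zero at the upper end, so only its value at l = 0 survives;
  -- that is the extra term in the first row of Θ.
  have htel := Finset.sum_range_sub' (fun l : ℕ => s * ((d : ℝ) + 1 - l) *
    (ipTs G α β (y l) (y l) - ipTs G α β (y l) (y (l + 1)))) (d + 1)
  have hsum : ∑ l ∈ Finset.range (d + 1), (s * ((((d + 1 : ℕ) : ℝ) - l)
        * normSqTs G α β (y l - y (l + 1)))
      - s * (-((d : ℝ) + 1 - l) * ipTs G α β (y l) (y (l + 1))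
        + (2 * ((d : ℝ) + 1 - l) - 1) * ipTs G α β (y (l + 1)) (y (l + 1))
        - ((d : ℝ) + 1 - l - 1) * ipTs G α β (y (l + 1)) (y (l + 2))))
      = ∑ l ∈ Finset.range (d + 1), (s * ((d : ℝ) + 1 - l) *
        (ipTs G α β (y l) (y l) - ipTs G α β (y l) (y (l + 1)))
      - s * ((d : ℝ) + 1 - (l + 1 : ℕ)) *
        (ipTs G α β (y (l + 1)) (y (l + 1)) - ipTs G α β (y (l + 1)) (y (l + 1 + 1)))) := by
    refine Finset.sum_congr rfl fun l _ => ?_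
    rw [normSqTs_sub]
    change s * (_ * (ipTs G α β (y l) (y l) - _ + ipTs G α β (y (l + 1)) (y (l + 1)))) - _ = _
    push_cast
    ring
  rw [htel, Finset.sum_sub_distrib, ← Finset.mul_sum] at hsum
  change _ = ipTs G α β (y 0) (y 0) + _
  push_cast at hsum ⊢
  linarith

theorem normSqTheta_stackV (P : Fin m → ℝ) (U : ℕ → State G T) (k : ℕ) (Us : State G T) :
    normSqTheta G α β P d (stackV U d k - fun _ => Us) = normSqTs G α β (U k - Us)
      + √(Pmin P / kappaS G α β T) *
        ∑ l ∈ Finset.range d, ((d : ℝ) - l) * normSqTs G α β (U (k - l) - U (k - (l + 1))) := by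
  have := normSqTheta_eq (α := α) (β := β) (d := d) P fun l => U (k - l) - Us
  simp only [sub_sub_sub_cancel_right, Nat.sub_zero] at this
  exact this

/-- After the shift the newest increment has weight d, and each older one has lost a unit of weight.
The oldest increment drops out with weight zero. -/
theorem normSqTheta_stackV_succ (P : Fin m → ℝ) (U : ℕ → State G T) (k : ℕ) (Us : State G T) :
    normSqTheta G α β P d (stackV U d (k + 1) - fun _ => Us) =
      normSqTs G α β (U (k + 1) - Us) + √(Pmin P / kappaS G α β T) *
        (d * normSqTs G α β (U (k + 1) - U k)
        + ∑ l ∈ Finset.range d,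
          ((d : ℝ) - l - 1) * normSqTs G α β (U (k - l) - U (k - (l + 1)))) := by
  rw [normSqTheta_stackV]
  have h1 := Finset.sum_range_succ
    (fun l : ℕ => ((d : ℝ) - l) * normSqTs G α β (U (k + 1 - l) - U (k + 1 - (l + 1)))) d
  rw [sub_self, zero_mul, add_zero, Finset.sum_range_succ'] at h1
  rw [← h1]
  congr 2
  rw [add_comm]
  congr 1
  · simp
  · refine Finset.sum_congr rfl fun l _ => ?_
    rw [Nat.add_sub_add_right, Nat.add_sub_add_right]
    push_cast
    ring

theorem normSqTheta_nonneg (hα : ∀ i, 0 < α i) (hβ : ∀ e ∈ G.edgeSet, 0 < β e) (P : Fin m → ℝ)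
    (U : ℕ → State G T) (k : ℕ) (Us : State G T) :
    0 ≤ normSqTheta G α β P d (stackV U d k - fun _ => Us) := by
  rw [normSqTheta_stackV]
  refine add_nonneg (normSqTs_nonneg hα hβ _) (mul_nonneg (Real.sqrt_nonneg _)
    (Finset.sum_nonneg fun l hl => mul_nonneg ?_ (normSqTs_nonneg hα hβ _)))
  have : (l : ℝ) ≤ d := by exact_mod_cast (Finset.mem_range.1 hl).le
  linarith

end Theta

/-! ### The error caused by delayed information -/

section Delay

/-- The error telescopes into δ ≤ d increments x. Each is handled by Young's inequality in the form
s x² + 2qxz + q²z²/s = (s x + q z)²/s ≥ 0, and the sum is then padded with nonnegative terms up to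
d. -/
theorem delay_error_le (u : ℕ → ℝ) (k : ℕ) {δ : ℕ} (hδ : δ ≤ d) (q z : ℝ) {s : ℝ} (hs : 0 < s) :
    -2 * q * ((u k - u (k - δ)) * z) ≤
      s * ∑ l ∈ Finset.range d, (u (k - l) - u (k - (l + 1))) ^ 2 + d * q ^ 2 / s * z ^ 2 := by
  have hnn : ∀ l, 0 ≤ s * (u (k - l) - u (k - (l + 1))) ^ 2 + q ^ 2 / s * z ^ 2 := fun l => by
    positivity
  have htel := Finset.sum_range_sub' (fun l => u (k - l)) δ
  rw [Nat.sub_zero] at htel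
  calc -2 * q * ((u k - u (k - δ)) * z)
      = ∑ l ∈ Finset.range δ, -2 * q * ((u (k - l) - u (k - (l + 1))) * z) := by
        rw [← htel, Finset.sum_mul, Finset.mul_sum]
    _ ≤ ∑ l ∈ Finset.range δ, (s * (u (k - l) - u (k - (l + 1))) ^ 2 + q ^ 2 / s * z ^ 2) := by
        refine Finset.sum_le_sum fun l _ => ?_
        set x := u (k - l) - u (k - (l + 1))
        have h : s * x ^ 2 + q ^ 2 / s * z ^ 2 - -2 * q * (x * z) = (s * x + q * z) ^ 2 / s := by
          field_simp
          ring
        have : 0 ≤ (s * x + q * z) ^ 2 / s := by positivity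
        linarith
    _ ≤ ∑ l ∈ Finset.range d, (s * (u (k - l) - u (k - (l + 1))) ^ 2 + q ^ 2 / s * z ^ 2) :=
        Finset.sum_le_sum_of_subset_of_nonneg (Finset.range_mono hδ) fun l _ _ => hnn l
    _ = _ := by
        rw [Finset.sum_add_distrib, ← Finset.mul_sum, Finset.sum_const, Finset.card_range,
          nsmul_eq_mul]
        ring

variable {G : SimpleGraph (Fin m)} [DecidableRel G.Adj] {α : Fin m → ℝ} {β : Sym2 (Fin m) → ℝ}

/-- `Ts` is diagonal, so the scalar estimate applies coordinate by coordinate even though the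
coordinates carry different delays. -/
theorem ipTs_delayed_le (hα : ∀ i, 0 < α i) (hβ : ∀ e ∈ G.edgeSet, 0 < β e) (U : ℕ → State G T)
    (k : ℕ) {τ : Fin m → ℕ} {ς : Sym2 (Fin m) → ℕ} (hτ : ∀ i, τ i ≤ d)
    (hς : ∀ e ∈ G.edgeSet, ς e ≤ d) (Z : State G T) (q : ℝ) {s : ℝ} (hs : 0 < s) :
    -2 * q * ipTs G α β (U k - delayed U k τ ς) Z ≤
      s * ∑ l ∈ Finset.range d, normSqTs G α β (U (k - l) - U (k - (l + 1)))
        + d * q ^ 2 / s * normSqTs G α β Z := by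
  simp only [ipTs_eq, normSqTs_eq]
  rw [Finset.sum_comm, Finset.mul_sum, Finset.mul_sum, Finset.mul_sum, ← Finset.sum_add_distrib]
  refine Finset.sum_le_sum fun i _ => ?_
  rw [Finset.sum_comm, Finset.mul_sum, Finset.mul_sum, Finset.mul_sum, ← Finset.sum_add_distrib]
  refine Finset.sum_le_sum fun c _ => ?_
  have h1 := delay_error_le (fun n => (U n).1 i c) k (hς _ (edge_mem c.1)) q (Z.1 i c) hs
  have h2 := delay_error_le (fun n => (U n).2 i c) k (hτ i) q (Z.2 i c) hs
  have h3 := mul_le_mul_of_nonneg_left h1 (inv_pos.2 (hβ _ (edge_mem c.1))).le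
  have h4 := mul_le_mul_of_nonneg_left h2 (inv_pos.2 (hα i)).le
  simp only [delayed, Prod.fst_sub, Prod.snd_sub, Pi.sub_apply]
  rw [Finset.sum_add_distrib, ← Finset.mul_sum, ← Finset.mul_sum]
  linarith

end Delay

section Owned

variable {G : SimpleGraph (Fin m)} [DecidableRel G.Adj] {α : Fin m → ℝ} {β : Sym2 (Fin m) → ℝ}

theorem sum_ipTs_owned (X Z : State G T) : ∑ i, ipTs G α β X (owned i Z) = ipTs G α β X Z := by
  simp only [ipTs_eq]
  rw [Finset.sum_comm]
  refine Finset.sum_congr rfl fun i' _ => ?_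
  rw [Finset.sum_eq_single i']
  · simp [owned]
  · intro i _ hi
    simp [owned, hi.symm]
  · simp

theorem sum_normSqTs_owned (Z : State G T) :
    ∑ i, normSqTs G α β (owned i Z) = normSqTs G α β Z := by
  simp only [normSqTs_eq]
  rw [Finset.sum_comm]
  refine Finset.sum_congr rfl fun i' _ => ?_
  rw [Finset.sum_eq_single i']
  · simp [owned]
  · intro i _ hi
    simp [owned, hi.symm]
  · simp

end Owned

/-! ### The averaged one-step inequality -/

namespace Market

variable {G : SimpleGraph (Fin m)} [DecidableRel G.Adj] (M : Market G T)
  {α : Fin m → ℝ} {β : Sym2 (Fin m) → ℝ}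

/-- The fundamental inequality of the asynchronous iteration, averaged over the activated agent. -/
theorem sum_asynStep_le (hα : ∀ i, 0 < α i) (hβ : ∀ e ∈ G.edgeSet, 0 < β e)
    (hκ : 1 ≤ kappaS G α β T) {P θ : Fin m → ℝ} (hP : ∀ i, 0 < P i) (hPsum : ∑ i, P i = 1)
    {q : ℝ} (hq0 : 0 < q) (hq : ∀ i, θ i * P i = q) (Us : State G T) (U : ℕ → State G T)
    (k : ℕ) {τ : Fin m → ℕ} {ς : Sym2 (Fin m) → ℕ} (hτ : ∀ i, τ i ≤ d)
    (hς : ∀ e ∈ G.edgeSet, ς e ≤ d) (i₀ : Fin m) :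
    ∑ i, P i * (normSqTs G α β (M.asynStep α β θ i (U k) (delayed U k τ ς) - Us)
      + √(Pmin P / kappaS G α β T) *
        (d * normSqTs G α β (M.asynStep α β θ i (U k) (delayed U k τ ς) - U k)
        + ∑ l ∈ Finset.range d,
          ((d : ℝ) - l - 1) * normSqTs G α β (U (k - l) - U (k - (l + 1))))) ≤
      normSqTheta G α β P d (stackV U d k - fun _ => Us)
        - q * M.decrease α β (delayed U k τ ς) Us
        - varpi G α β T P θ d i₀ * q ^ 2 * normSqTs G α β (M.Zop α β (delayed U k τ ς)) := by
  have : Nonempty (Fin m) := ⟨i₀⟩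
  rw [normSqTheta_stackV]
  set K := kappaS G α β T
  set p := Pmin P with hp
  have hp0 : 0 < p := by
    obtain ⟨j, hj⟩ := exists_eq_ciInf_of_finite (f := P)
    rw [hp, Pmin, ← hj]
    exact hP j
  have hK0 : 0 < K := by linarith
  set s := √(p / K) with hs
  have hs0 : 0 < s := Real.sqrt_pos.2 (by positivity)
  set Uh := delayed U k τ ς with hUh
  set Z := M.Zop α β Uh with hZ
  set N := normSqTs G α β Z with hN
  have hN0 : 0 ≤ N := normSqTs_nonneg hα hβ _
  set S1 := ∑ l ∈ Finset.range d, ((d : ℝ) - l - 1) * normSqTs G α β (U (k - l) - U (k - (l + 1)))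
    with hS1
  set D := ∑ l ∈ Finset.range d, normSqTs G α β (U (k - l) - U (k - (l + 1))) with hD
  have hS : ∑ l ∈ Finset.range d, ((d : ℝ) - l) * normSqTs G α β (U (k - l) - U (k - (l + 1)))
      = S1 + D := by
    rw [hS1, hD, ← Finset.sum_add_distrib]
    exact Finset.sum_congr rfl fun l _ => by ring
  -- The cross term is exact since P_i θ_i = q. In the quadratic term P_i θ_i² = q²/P_i ≤ q²/P_min,
  -- and the factor 1 + s d joins the step itself to the newest increment of the Θ-norm.
  have h1 : ∀ i, P i * (normSqTs G α β (M.asynStep α β θ i (U k) Uh - Us)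
      + s * (d * normSqTs G α β (M.asynStep α β θ i (U k) Uh - U k) + S1))
      ≤ P i * (normSqTs G α β (U k - Us) + s * S1)
        - 2 * q * ipTs G α β (U k - Us) (owned i Z)
        + (1 + s * d) * (q ^ 2 / p) * normSqTs G α β (owned i Z) := by
    intro i
    have e1 : M.asynStep α β θ i (U k) Uh - Us = (U k - Us) - θ i • owned i Z := by
      rw [asynStep_eq]; abel
    have e2 : M.asynStep α β θ i (U k) Uh - U k = -(θ i • owned i Z) := by
      rw [asynStep_eq]; abel
    rw [e1, e2, normSqTs_neg, normSqTs_sub, normSqTs_smul, ipTs_smul_right]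
    have hn := normSqTs_nonneg hα hβ (owned i Z)
    set n := normSqTs G α β (owned i Z)
    have hθ : P i * θ i ^ 2 ≤ q ^ 2 / p := by
      rw [le_div_iff₀ hp0]
      have hpi : p ≤ P i := ciInf_le (Set.finite_range P).bddBelow i
      calc P i * θ i ^ 2 * p ≤ P i * θ i ^ 2 * P i :=
            mul_le_mul_of_nonneg_left hpi (mul_nonneg (hP i).le (sq_nonneg _))
        _ = q ^ 2 := by rw [← hq i]; ring
    have h2 := mul_le_mul_of_nonneg_right hθ (mul_nonneg (by positivity : 0 ≤ 1 + s * d) hn)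
    rw [← hq i] at h2 ⊢
    linarith
  have h2 := Finset.sum_le_sum fun i (_ : i ∈ Finset.univ) => h1 i
  refine h2.trans ?_
  rw [Finset.sum_add_distrib, Finset.sum_sub_distrib, ← Finset.sum_mul, ← Finset.mul_sum,
    ← Finset.mul_sum, sum_ipTs_owned, sum_normSqTs_owned, hPsum, hS, decrease, ← hZ, ← hN]
  have h3 := ipTs_delayed_le hα hβ U k hτ hς Z q hs0
  rw [← hUh, ← hD, ← hN] at h3
  -- The first part belongs to `decrease` at the delayed state; the second is the delay error, paid
  -- for by D.
  have h4 : ipTs G α β (U k - Us) Z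
      = ipTs G α β (Uh - Us) Z + ipTs G α β (U k - Uh) Z := by
    rw [ipTs_comm _ Z, ipTs_comm _ Z, ipTs_comm _ Z, ← ipTs_add_right]
    congr 1
    abel
  -- The constant ϖ comes from this bound. As s² = P_min/κ_s ≤ P_min, both d/s and d s/P_min are at
  -- most d √(κ_s/P_min), whence the factor 2, and 1/P_min ≤ κ_s/P_min.
  have h5 : d * q ^ 2 / s + (1 + s * d) * (q ^ 2 / p)
      ≤ q - varpi G α β T P θ d i₀ * q ^ 2 := by
    have e1 : √(K / p) = 1 / s := by
      rw [hs, one_div, ← Real.sqrt_inv, inv_div]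
    have e2 : s / p ≤ 1 / s := by
      rw [div_le_div_iff₀ hp0 hs0, one_mul, ← sq, hs, Real.sq_sqrt (by positivity)]
      exact div_le_self hp0.le hκ
    have e3 : 1 / p ≤ K / p := by gcongr
    have e4 : varpi G α β T P θ d i₀ = 1 / q - 2 * d * (1 / s) - K / p := by
      rw [varpi, hq, e1]
    rw [e4]
    have e5 : (1 / q) * q ^ 2 = q := by field_simp
    have e6 : (d : ℝ) * (s / p) ≤ d * (1 / s) := mul_le_mul_of_nonneg_left e2 (by positivity)
    have e7 := mul_le_mul_of_nonneg_right (add_le_add e6 e3) (sq_nonneg q)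
    calc d * q ^ 2 / s + (1 + s * d) * (q ^ 2 / p)
        = d * (1 / s) * q ^ 2 + (d * (s / p) + 1 / p) * q ^ 2 := by ring
      _ ≤ d * (1 / s) * q ^ 2 + (d * (1 / s) + K / p) * q ^ 2 := by linarith
      _ = q - (1 / q - 2 * d * (1 / s) - K / p) * q ^ 2 := by rw [← e5]; field_simp; ring
  have h6 := mul_le_mul_of_nonneg_right h5 hN0
  rw [h4]
  linarith

end Market

end DYNA

/-! ### Conditioning on a random index and supermartingale convergence -/

namespace DYNA

section Abstract

variable {Ω : Type*} {𝓕 m0 : MeasurableSpace Ω} {μ : Measure Ω}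

theorem measurable_apply_countable {ι E : Type*} [Countable ι] [MeasurableSpace ι]
    [MeasurableSingletonClass ι] [MeasurableSpace E] {f : ι → Ω → E} {n : Ω → ι}
    (hf : ∀ i, Measurable (f i)) (hn : Measurable n) : Measurable fun ω => f (n ω) ω :=
  (measurable_from_prod_countable_left (f := fun p : Ω × ι => f p.2 p.1) hf).comp
    (measurable_id.prodMk hn)

/-- Conditioning on a σ-algebra that is independent of a random index averages over the index. -/
theorem condExp_apply_index [IsProbabilityMeasure μ] {ι : Type*} [Fintype ι] [MeasurableSpace ι]
    [MeasurableSingletonClass ι] (h𝓕 : 𝓕 ≤ m0) {a : Ω → ι}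
    (ha : Measurable a) (hindep : Indep (MeasurableSpace.comap a inferInstance) 𝓕 μ)
    {H : ι → Ω → ℝ} (hH : ∀ i, StronglyMeasurable[𝓕] (H i)) (hHint : ∀ i, Integrable (H i) μ) :
    Integrable (fun ω => H (a ω) ω) μ ∧
      μ[fun ω => H (a ω) ω | 𝓕] =ᵐ[μ] fun ω => ∑ i, μ.real {ω | a ω = i} * H i ω := by
  classical
  -- The variable is split over the values of the index: the factor H i is measurable for the
  -- conditioning σ-algebra and comes out, and the indicator is independent of it.
  set e : ι → Ω → ℝ := fun i => Set.indicator {ω | a ω = i} 1 with he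
  have hset : ∀ i, MeasurableSet {ω | a ω = i} := fun i => ha (measurableSet_singleton i)
  have heint : ∀ i, Integrable (e i) μ := fun i =>
    (integrable_const (1 : ℝ)).indicator (hset i)
  have hprod : ∀ i, e i * H i = Set.indicator {ω | a ω = i} (H i) := by
    intro i
    ext ω
    by_cases h : a ω = i <;> simp [he, h]
  have hint : ∀ i, Integrable (e i * H i) μ := fun i => by
    rw [hprod]
    exact (hHint i).indicator (hset i)
  have hsum : (fun ω => H (a ω) ω) = ∑ i, e i * H i := by
    ext ω
    rw [Finset.sum_apply, Finset.sum_eq_single (a ω)]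
    · simp [he]
    · intro i _ hi
      simp [he, hi.symm]
    · simp
  have hcond : ∀ i, μ[e i * H i | 𝓕] =ᵐ[μ] fun ω => μ.real {ω | a ω = i} * H i ω := by
    intro i
    have h1 := condExp_mul_of_stronglyMeasurable_right (hH i) (hint i) (heint i)
    have h2 : μ[e i | 𝓕] =ᵐ[μ] fun _ => μ[e i] := by
      refine condExp_indep_eq ha.comap_le h𝓕 ?_ hindep
      refine StronglyMeasurable.indicator stronglyMeasurable_one ?_
      exact ⟨{i}, measurableSet_singleton i, rfl⟩
    filter_upwards [h1, h2] with ω hω1 hω2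
    rw [hω1, Pi.mul_apply, hω2, ← integral_indicator_one (hset i)]
  refine ⟨?_, ?_⟩
  · rw [hsum]
    exact integrable_finsetSum' _ fun i _ => hint i
  · rw [hsum]
    refine (condExp_finsetSum (fun i _ => hint i) _).trans ?_
    have h := eventually_all.2 hcond
    filter_upwards [h] with ω hω
    rw [Finset.sum_apply]
    exact Finset.sum_congr rfl fun i _ => hω i

/-- A simple form of the Robbins–Siegmund lemma. -/
theorem exists_tendsto_of_condExp_le [IsProbabilityMeasure μ] {ℱ : Filtration ℕ m0}
    {X Y : ℕ → Ω → ℝ} (hX0 : ∀ k ω, 0 ≤ X k ω) (hY0 : ∀ k ω, 0 ≤ Y k ω)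
    (hX : ∀ k, StronglyMeasurable[ℱ k] (X k)) (hY : ∀ k, StronglyMeasurable[ℱ k] (Y k))
    (hXi : ∀ k, Integrable (X k) μ) (hYi : ∀ k, Integrable (Y k) μ)
    (h : ∀ k, ∀ᵐ ω ∂μ, (μ[X (k + 1) | ℱ k]) ω ≤ X k ω - Y k ω) :
    ∀ᵐ ω ∂μ, (∃ c, Tendsto (fun k => X k ω) atTop (𝓝 c)) ∧
      Tendsto (fun k => Y k ω) atTop (𝓝 0) := by
  -- Adding the accumulated decreases yields a nonnegative supermartingale. Its limit bounds the
  -- partial sums of Y, so Y is summable and X converges as a difference.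
  set W : ℕ → Ω → ℝ := fun k => X k + ∑ n ∈ Finset.range k, Y n with hW
  have hSm : ∀ k, StronglyMeasurable[ℱ k] (∑ n ∈ Finset.range (k + 1), Y n) := fun k =>
    Finset.stronglyMeasurable_sum _ fun n hn =>
      (hY n).mono (ℱ.mono (Nat.lt_succ_iff.1 (Finset.mem_range.1 hn)))
  have hSi : ∀ k, Integrable (∑ n ∈ Finset.range k, Y n) μ := fun k =>
    integrable_finsetSum' _ fun n _ => hYi n
  have hWm : StronglyAdapted ℱ W := fun k =>
    (hX k).add (Finset.stronglyMeasurable_sum _ fun n hn =>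
      (hY n).mono (ℱ.mono (Finset.mem_range.1 hn).le))
  have hWi : ∀ k, Integrable (W k) μ := fun k => (hXi k).add (hSi k)
  have hW0 : ∀ k ω, 0 ≤ W k ω := fun k ω => by
    simp only [hW, Pi.add_apply, Finset.sum_apply]
    exact add_nonneg (hX0 k ω) (Finset.sum_nonneg fun n _ => hY0 n ω)
  have hsuper : Supermartingale W ℱ μ := by
    refine supermartingale_nat hWm hWi fun k => ?_
    have h1 := condExp_add (m := ℱ k) (hXi (k + 1)) (hSi (k + 1))
    rw [condExp_of_stronglyMeasurable (ℱ.le k) (hSm k) (hSi (k + 1))] at h1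
    filter_upwards [h1, h k] with ω hω1 hω2
    rw [hω1]
    simp only [hW, Pi.add_apply, Finset.sum_apply]
    rw [Finset.sum_range_succ]
    linarith
  have hbdd : ∀ k, eLpNorm ((-W) k) 1 μ ≤ (Real.toNNReal (∫ ω, W 0 ω ∂μ) : ENNReal) := by
    intro k
    have h1 := hsuper.setIntegral_le (Nat.zero_le k) (MeasurableSet.univ)
    rw [setIntegral_univ, setIntegral_univ] at h1
    rw [Pi.neg_apply, eLpNorm_neg, eLpNorm_one_eq_lintegral_enorm,
      ← ofReal_integral_norm_eq_lintegral_enorm (hWi k)]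
    refine ENNReal.ofReal_le_ofReal (le_trans (le_of_eq ?_) h1)
    exact integral_congr_ae (ae_of_all _ fun ω => Real.norm_of_nonneg (hW0 k ω))
  filter_upwards [hsuper.neg.exists_ae_tendsto_of_bdd hbdd] with ω hω
  obtain ⟨c, hc⟩ := hω
  have hc' : Tendsto (fun k => W k ω) atTop (𝓝 (-c)) := by
    simpa using hc.neg
  obtain ⟨C, hC⟩ := hc'.bddAbove_range
  have hsummable : Summable fun n => Y n ω := by
    refine summable_of_sum_range_le (c := C) (fun n => hY0 n ω) fun n => ?_
    refine le_trans ?_ (hC ⟨n, rfl⟩)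
    simp only [hW, Pi.add_apply, Finset.sum_apply]
    linarith [hX0 n ω]
  refine ⟨⟨_, (hc'.sub hsummable.hasSum.tendsto_sum_nat).congr fun k => ?_⟩,
    hsummable.tendsto_atTop_zero⟩
  simp [hW]

end Abstract

variable {m T d : ℕ}

/-! ### Measurability and integrability of the iterates -/

section Iterates

variable {G : SimpleGraph (Fin m)} [DecidableRel G.Adj] {Ω : Type*}

omit [DecidableRel G.Adj] in
theorem opensMeasurableSpace_state : OpensMeasurableSpace (State G T) := inferInstance

omit [DecidableRel G.Adj] in
theorem secondCountableTopology_state : SecondCountableTopology (State G T) := inferInstance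

omit [DecidableRel G.Adj] in
theorem opensMeasurableSpace_prod (X : Type*) [TopologicalSpace X] [MeasurableSpace X]
    [OpensMeasurableSpace X] [SecondCountableTopology X] :
    OpensMeasurableSpace (State G T × X) := Prod.opensMeasurableSpace

theorem continuous_normSqTs {α : Fin m → ℝ} {β : Sym2 (Fin m) → ℝ} :
    Continuous (normSqTs G α β : State G T → ℝ) := by
  simp only [funext fun X => normSqTs_eq (G := G) (T := T) (α := α) (β := β) X]
  fun_prop

theorem norm_delayed_le (V : ℕ → State G T) (k : ℕ) (τ : Fin m → ℕ) (ς : Sym2 (Fin m) → ℕ)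
    {C : ℝ} (hC0 : 0 ≤ C) (hτ : ∀ i, ‖V (k - τ i)‖ ≤ C)
    (hς : ∀ e ∈ G.edgeSet, ‖V (k - ς e)‖ ≤ C) : ‖delayed V k τ ς‖ ≤ C := by
  refine norm_prod_le_iff.2 ⟨?_, ?_⟩
  · refine (pi_norm_le_iff_of_nonneg hC0).2 fun i => (pi_norm_le_iff_of_nonneg hC0).2 fun c => ?_
    set W := V (k - ς s(i, c.1.1)) with hW
    have h1 : ‖W.1 i c‖ ≤ ‖W.1 i‖ := norm_le_pi_norm (W.1 i) c
    have h2 : ‖W.1 i‖ ≤ ‖W.1‖ := norm_le_pi_norm W.1 i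
    exact h1.trans (h2.trans ((norm_fst_le W).trans (hς _ (edge_mem c.1))))
  · refine (pi_norm_le_iff_of_nonneg hC0).2 fun i => ?_
    set W := V (k - τ i) with hW
    have h2 : ‖W.2 i‖ ≤ ‖W.2‖ := norm_le_pi_norm W.2 i
    exact h2.trans ((norm_snd_le W).trans (hτ i))

theorem measurable_delayed [MeasurableSpace Ω] {U : ℕ → Ω → State G T} {k : ℕ}
    (hU : ∀ n ≤ k, Measurable (U n)) {τ : Ω → Fin m → ℕ} {ς : Ω → Sym2 (Fin m) → ℕ}
    (hτ : ∀ i, Measurable fun ω => τ ω i) (hς : ∀ e ∈ G.edgeSet, Measurable fun ω => ς ω e) :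
    Measurable fun ω => delayed (fun n => U n ω) k (τ ω) (ς ω) := by
  have h1 : ∀ n, Measurable (U (k - n)) := fun n => hU _ (Nat.sub_le _ _)
  refine Measurable.prodMk ?_ ?_
  · refine measurable_pi_lambda _ fun i => measurable_pi_lambda _ fun c => ?_
    have h2 : Measurable fun ω => U (k - ς ω s(i, c.1.1)) ω :=
      measurable_apply_countable (f := fun n => U (k - n)) h1 (hς _ (edge_mem c.1))
    exact (measurable_pi_apply c).comp ((measurable_pi_apply i).comp (measurable_fst.comp h2))
  · refine measurable_pi_lambda _ fun i => ?_
    have h2 : Measurable fun ω => U (k - τ ω i) ω :=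
      measurable_apply_countable (f := fun n => U (k - n)) h1 (hτ i)
    exact (measurable_pi_apply i).comp (measurable_snd.comp h2)

theorem exists_bound_comp {E F : Type*} [NormedAddCommGroup E] [ProperSpace E]
    [NormedAddCommGroup F] {φ : E → F} (hφ : Continuous φ) (C : ℝ) :
    ∃ C', ∀ x, ‖x‖ ≤ C → ‖φ x‖ ≤ C' := by
  obtain ⟨C', hC'⟩ := (isCompact_closedBall (0 : E) C).exists_bound_of_continuousOn
    hφ.continuousOn
  exact ⟨C', fun x hx => hC' x (by simpa using hx)⟩

variable [MeasurableSpace Ω] (M : Market G T) {α : Fin m → ℝ} {β : Sym2 (Fin m) → ℝ}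
  {act : ℕ → Ω → Fin m} {τ : ℕ → Ω → Fin m → ℕ} {ς : ℕ → Ω → Sym2 (Fin m) → ℕ} {θ : Fin m → ℝ}
  {U Uh : ℕ → Ω → State G T} {U₀ : State G T}

theorem measurable_iterates (hne : ∀ i, (M.localSet i).Nonempty) (hact : ∀ k, Measurable (act k))
    (hτm : ∀ k i, Measurable fun ω => τ k ω i)
    (hςm : ∀ k, ∀ e ∈ G.edgeSet, Measurable fun ω => ς k ω e) (hU₀ : ∀ ω, U 0 ω = U₀)
    (hUh : ∀ k ω, Uh k ω = delayed (fun n => U n ω) k (τ k ω) (ς k ω))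
    (hU : ∀ k ω, U (k + 1) ω = M.asynStep α β θ (act k ω) (U k ω) (Uh k ω)) (k : ℕ) :
    Measurable (U k) ∧ Measurable (Uh k) := by
  have hh : ∀ k, (∀ n ≤ k, Measurable (U n)) → Measurable (Uh k) := fun k hk => by
    rw [funext (hUh k)]
    exact measurable_delayed hk (hτm k) (hςm k)
  -- The induction carries all earlier iterates, since delayed states look back.
  have key : ∀ k, ∀ n ≤ k, Measurable (U n) := by
    intro k
    induction k with
    | zero =>
      intro n hn
      obtain rfl := Nat.le_zero.1 hn
      rw [funext hU₀]
      exact measurable_const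
    | succ k ih =>
      intro n hn
      rcases Nat.le_succ_iff.1 hn with hn | rfl
      · exact ih n hn
      · rw [funext (hU k)]
        refine measurable_apply_countable
          (f := fun i ω => M.asynStep α β θ i (U k ω) (Uh k ω)) (fun i => ?_) (hact k)
        have := opensMeasurableSpace_prod (G := G) (T := T) (State G T)
        exact (M.continuous_asynStep α β hne θ i).measurable.comp
          ((ih k le_rfl).prodMk (hh k ih))
  exact ⟨key k k le_rfl, hh k (key k)⟩

-- Starting from a deterministic point, a bounded set is mapped by finitely many continuous maps
-- into a bounded set. The bound is uniform in ω but depends on k; it serves only for integrability.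
omit [MeasurableSpace Ω] in
theorem bounded_iterates (hne : ∀ i, (M.localSet i).Nonempty) (hU₀ : ∀ ω, U 0 ω = U₀)
    (hUh : ∀ k ω, Uh k ω = delayed (fun n => U n ω) k (τ k ω) (ς k ω))
    (hU : ∀ k ω, U (k + 1) ω = M.asynStep α β θ (act k ω) (U k ω) (Uh k ω)) (k : ℕ) :
    ∃ C, (∀ n ≤ k, ∀ ω, ‖U n ω‖ ≤ C) ∧ ∀ ω, ‖Uh k ω‖ ≤ C := by
  have key : ∃ C, ∀ n ≤ k, ∀ ω, ‖U n ω‖ ≤ C := by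
    induction k with
    | zero =>
      refine ⟨‖U₀‖, fun n hn ω => ?_⟩
      obtain rfl := Nat.le_zero.1 hn
      rw [hU₀]
    | succ k ih =>
      obtain ⟨C, hC⟩ := ih
      have hCh : ∀ ω, ‖Uh k ω‖ ≤ C := fun ω => by
        rw [hUh]
        exact norm_delayed_le _ _ _ _ ((norm_nonneg _).trans (hC k le_rfl ω))
          (fun _ => hC _ (Nat.sub_le _ _) ω) fun _ _ => hC _ (Nat.sub_le _ _) ω
      choose C' hC' using fun i => exists_bound_comp (M.continuous_asynStep α β hne θ i) C
      refine ⟨max C (∑ i, |C' i|), fun n hn ω => ?_⟩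
      rcases Nat.le_succ_iff.1 hn with hn | rfl
      · exact (hC n hn ω).trans (le_max_left _ _)
      · rw [hU]
        refine (hC' (act k ω) (U k ω, Uh k ω)
          (norm_prod_le_iff.2 ⟨hC k le_rfl ω, hCh ω⟩)).trans ?_
        exact (le_abs_self _).trans ((Finset.single_le_sum (f := fun i => |C' i|)
          (fun _ _ => abs_nonneg _) (Finset.mem_univ _)).trans (le_max_right _ _))
  obtain ⟨C, hC⟩ := key
  exact ⟨C, hC, fun ω => by
    rw [hUh]
    exact norm_delayed_le _ _ _ _ ((norm_nonneg _).trans (hC k le_rfl ω))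
          (fun _ => hC _ (Nat.sub_le _ _) ω) fun _ _ => hC _ (Nat.sub_le _ _) ω⟩

omit [DecidableRel G.Adj] [MeasurableSpace Ω] in
theorem hist_mono : Monotone (hist U Uh) := by
  intro k l hkl
  exact sup_le_sup (biSup_mono fun n hn => ⟨hn.1, hn.2.trans hkl⟩)
    (biSup_mono fun n hn => ⟨hn.1, hn.2.trans hkl⟩)

omit [DecidableRel G.Adj] in
theorem hist_le (hU : ∀ k, Measurable (U k)) (hUh : ∀ k, Measurable (Uh k)) (k : ℕ) :
    hist U Uh k ≤ ‹MeasurableSpace Ω› :=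
  sup_le (iSup₂_le fun n _ => (hU n).comap_le) (iSup₂_le fun n _ => (hUh n).comap_le)

omit [DecidableRel G.Adj] [MeasurableSpace Ω] in
theorem measurable_hist {k n : ℕ} (hn : n ≤ k) : Measurable[hist U Uh k] (U n) :=
  Measurable.of_comap_le (le_sup_of_le_left
    (le_iSup₂_of_le n (Set.mem_Icc.2 ⟨Nat.zero_le n, hn⟩) le_rfl))

omit [DecidableRel G.Adj] [MeasurableSpace Ω] in
theorem measurable_hist_delayed
    (hUh : ∀ k ω, Uh k ω = delayed (fun n => U n ω) k (τ k ω) (ς k ω)) (k : ℕ) :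
    Measurable[hist U Uh k] (Uh k) := by
  rcases k with _ | k
  · have : Uh 0 = U 0 := by
      ext1 ω
      rw [hUh]
      simp [delayed]
    rw [this]
    exact measurable_hist le_rfl
  · exact Measurable.of_comap_le (le_sup_of_le_right
      (le_iSup₂_of_le (k + 1) (Set.mem_Icc.2 ⟨Nat.succ_le_succ (Nat.zero_le k), le_rfl⟩) le_rfl))

omit [DecidableRel G.Adj] [MeasurableSpace Ω] in
theorem measurable_hist_state
    (hUh : ∀ k ω, Uh k ω = delayed (fun n => U n ω) k (τ k ω) (ς k ω)) (k : ℕ) :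
    Measurable[hist U Uh k] fun ω => (Uh k ω, fun n : Fin (k + 1) => U n ω) := by
  let := hist U Uh k
  exact (measurable_hist_delayed hUh k).prodMk
    (measurable_pi_lambda _ fun n => measurable_hist (Nat.lt_succ_iff.1 n.2))

/-- Continuous functions of the history are measurable with respect to it and integrable. -/
theorem stronglyMeasurable_and_integrable {μ : Measure Ω} [IsProbabilityMeasure μ]
    (hne : ∀ i, (M.localSet i).Nonempty) (hact : ∀ k, Measurable (act k))
    (hτm : ∀ k i, Measurable fun ω => τ k ω i)
    (hςm : ∀ k, ∀ e ∈ G.edgeSet, Measurable fun ω => ς k ω e) (hU₀ : ∀ ω, U 0 ω = U₀)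
    (hUh : ∀ k ω, Uh k ω = delayed (fun n => U n ω) k (τ k ω) (ς k ω))
    (hU : ∀ k ω, U (k + 1) ω = M.asynStep α β θ (act k ω) (U k ω) (Uh k ω)) (k : ℕ)
    {φ : State G T × (Fin (k + 1) → State G T) → ℝ} (hφ : Continuous φ) :
    StronglyMeasurable[hist U Uh k] (fun ω => φ (Uh k ω, fun n => U n ω)) ∧
      Integrable (fun ω => φ (Uh k ω, fun n => U n ω)) μ := by
  have hm := fun k => measurable_iterates M hne hact hτm hςm hU₀ hUh hU k
  have h1 : StronglyMeasurable[hist U Uh k] (fun ω => φ (Uh k ω, fun n => U n ω)) := by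
    have := opensMeasurableSpace_state (G := G) (T := T)
    have := secondCountableTopology_state (G := G) (T := T)
    have : OpensMeasurableSpace (Fin (k + 1) → State G T) := Pi.opensMeasurableSpace
    have := opensMeasurableSpace_prod (G := G) (T := T) (Fin (k + 1) → State G T)
    exact (hφ.measurable.comp (measurable_hist_state hUh k)).stronglyMeasurable
  refine ⟨h1, ?_⟩
  obtain ⟨C, hC, hCh⟩ := bounded_iterates M hne hU₀ hUh hU k
  obtain ⟨C', hC'⟩ := exists_bound_comp hφ C
  refine Integrable.of_bound (h1.mono (hist_le (fun k => (hm k).1) (fun k => (hm k).2) k)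
    ).aestronglyMeasurable C' (ae_of_all _ fun ω => hC' _ (norm_prod_le_iff.2 ⟨hCh ω, ?_⟩))
  exact (pi_norm_le_iff_of_nonneg ((norm_nonneg _).trans (hCh ω))).2 fun n =>
    hC n (Nat.lt_succ_iff.1 n.2) ω

end Iterates

end DYNA

/-! ### Convergence along a good realization -/

namespace DYNA

section Abstract

/-- A continuous function tends to zero along a bounded sequence on which another continuous
function with a smaller zero set does. -/
theorem tendsto_zero_of_tendsto_zero {E F F' : Type*} [NormedAddCommGroup E] [ProperSpace E]
    [NormedAddCommGroup F] [NormedAddCommGroup F'] {f : E → F} {g : E → F'} (hf : Continuous f)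
    (hg : Continuous g) (hfg : ∀ x, f x = 0 → g x = 0) {x : ℕ → E} {C : ℝ} (hx : ∀ n, ‖x n‖ ≤ C)
    (h : Tendsto (fun n => f (x n)) atTop (𝓝 0)) : Tendsto (fun n => g (x n)) atTop (𝓝 0) := by
  refine tendsto_of_subseq_tendsto fun ns hns => ?_
  obtain ⟨a, -, ms, hms, hlim⟩ := (isCompact_closedBall (0 : E) C).tendsto_subseq
    (x := fun n => x (ns n)) fun n => by simpa using hx (ns n)
  have h1 : f a = 0 := tendsto_nhds_unique ((hf.tendsto a).comp hlim)
    (h.comp (hns.comp hms.tendsto_atTop))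
  refine ⟨ms, ?_⟩
  rw [← hfg a h1]
  exact (hg.tendsto a).comp hlim

theorem tendsto_sub_succ {E : Type*} [NormedAddCommGroup E] {V : ℕ → E}
    (hV : Tendsto (fun k => V (k + 1) - V k) atTop (𝓝 0)) (l : ℕ) :
    Tendsto (fun k => V (k - l) - V (k - (l + 1))) atTop (𝓝 0) := by
  refine (hV.comp (tendsto_sub_atTop_nat (l + 1))).congr' ?_
  filter_upwards [eventually_ge_atTop (l + 1)] with k hk
  simp only [Function.comp_apply]
  congr 2
  omega

theorem norm_sub_le_sum {E : Type*} [NormedAddCommGroup E] (V : ℕ → E) (k : ℕ) {δ d : ℕ}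
    (hδ : δ ≤ d) :
    ‖V (k - δ) - V k‖ ≤ ∑ l ∈ Finset.range d, ‖V (k - l) - V (k - (l + 1))‖ := by
  have htel := Finset.sum_range_sub' (fun l => V (k - l)) δ
  rw [Nat.sub_zero] at htel
  rw [norm_sub_rev, ← htel]
  exact (norm_sum_le _ _).trans (Finset.sum_le_sum_of_subset_of_nonneg (Finset.range_mono hδ)
    fun _ _ _ => norm_nonneg _)

end Abstract

variable {m T d : ℕ} {G : SimpleGraph (Fin m)} [DecidableRel G.Adj] {α : Fin m → ℝ}
  {β : Sym2 (Fin m) → ℝ}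

theorem normSqTs_zero : normSqTs G α β (0 : State G T) = 0 := by
  simp [normSqTs_eq]

theorem exists_norm_sq_le (hα : ∀ i, 0 < α i) (hβ : ∀ e ∈ G.edgeSet, 0 < β e) :
    ∃ C, 0 ≤ C ∧ ∀ X : State G T, ‖X‖ ≤ √(C * normSqTs G α β X) := by
  set C := ∑ i, ∑ c : G.neighborSet i × Fin T, (β s(i, c.1.1) + α i) with hC
  have hw : ∀ i, ∀ c : G.neighborSet i × Fin T, 0 < β s(i, c.1.1) + α i := fun i c =>
    add_pos (hβ _ (edge_mem c.1)) (hα i)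
  have hC0 : 0 ≤ C := Finset.sum_nonneg fun i _ => Finset.sum_nonneg fun c _ => (hw i c).le
  have hwC : ∀ i, ∀ c : G.neighborSet i × Fin T, β s(i, c.1.1) + α i ≤ C := fun i c =>
    (Finset.single_le_sum (f := fun c : G.neighborSet i × Fin T => β s(i, c.1.1) + α i)
      (fun c _ => (hw i c).le) (Finset.mem_univ c)).trans
    (Finset.single_le_sum (f := fun i => ∑ c : G.neighborSet i × Fin T, (β s(i, c.1.1) + α i))
      (fun i _ => Finset.sum_nonneg fun c _ => (hw i c).le) (Finset.mem_univ i))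
  refine ⟨C, hC0, fun X => ?_⟩
  set F : (i : Fin m) → G.neighborSet i × Fin T → ℝ := fun i c =>
    (β s(i, c.1.1))⁻¹ * X.1 i c ^ 2 + (α i)⁻¹ * X.2 i c ^ 2 with hF
  have hF1 : ∀ i, ∀ c : G.neighborSet i × Fin T, 0 ≤ (β s(i, c.1.1))⁻¹ * X.1 i c ^ 2 :=
    fun i c => mul_nonneg (inv_pos.2 (hβ _ (edge_mem c.1))).le (sq_nonneg _)
  have hF2 : ∀ i, ∀ c : G.neighborSet i × Fin T, 0 ≤ (α i)⁻¹ * X.2 i c ^ 2 :=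
    fun i c => mul_nonneg (inv_pos.2 (hα i)).le (sq_nonneg _)
  have hF0 : ∀ i c, 0 ≤ F i c := fun i c => add_nonneg (hF1 i c) (hF2 i c)
  have hFn : ∀ i c, F i c ≤ normSqTs G α β X := fun i c => by
    rw [normSqTs_eq]
    exact (Finset.single_le_sum (f := fun c => F i c) (fun c _ => hF0 i c)
      (Finset.mem_univ c)).trans (Finset.single_le_sum (f := fun i => ∑ c, F i c)
      (fun i _ => Finset.sum_nonneg fun c _ => hF0 i c) (Finset.mem_univ i))
  have hn0 := normSqTs_nonneg hα hβ X
  refine norm_prod_le_iff.2 ⟨?_, ?_⟩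
  · refine (pi_norm_le_iff_of_nonneg (Real.sqrt_nonneg _)).2 fun i =>
      (pi_norm_le_iff_of_nonneg (Real.sqrt_nonneg _)).2 fun c => Real.abs_le_sqrt ?_
    have hb := hβ _ (edge_mem c.1)
    calc X.1 i c ^ 2 = β s(i, c.1.1) * ((β s(i, c.1.1))⁻¹ * X.1 i c ^ 2) := by
          rw [mul_inv_cancel_left₀ hb.ne']
      _ ≤ C * normSqTs G α β X := by
          refine mul_le_mul (by linarith [hwC i c, hα i]) ?_ (hF1 i c) hC0
          exact (le_add_of_nonneg_right (hF2 i c)).trans (hFn i c)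
  · refine (pi_norm_le_iff_of_nonneg (Real.sqrt_nonneg _)).2 fun i =>
      (pi_norm_le_iff_of_nonneg (Real.sqrt_nonneg _)).2 fun c => Real.abs_le_sqrt ?_
    have hb := hβ _ (edge_mem c.1)
    calc X.2 i c ^ 2 = α i * ((α i)⁻¹ * X.2 i c ^ 2) := by
          rw [mul_inv_cancel_left₀ (hα i).ne']
      _ ≤ C * normSqTs G α β X := by
          refine mul_le_mul (by linarith [hwC i c]) ?_ (hF2 i c) hC0
          exact (le_add_of_nonneg_left (hF1 i c)).trans (hFn i c)

theorem normSqTs_add_le (hα : ∀ i, 0 < α i) (hβ : ∀ e ∈ G.edgeSet, 0 < β e) (X Y : State G T) :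
    normSqTs G α β (X + Y) ≤ 2 * normSqTs G α β X + 2 * normSqTs G α β Y := by
  have h1 := normSqTs_sub (α := α) (β := β) X Y
  have h2 := normSqTs_sub (α := α) (β := β) X (-Y)
  have h3 : ipTs G α β X (-Y) = -ipTs G α β X Y := by
    rw [← neg_one_smul ℝ Y, ipTs_smul_right, neg_one_mul]
  rw [sub_neg_eq_add, normSqTs_neg, h3] at h2
  have := normSqTs_nonneg hα hβ (X - Y)
  linarith

namespace Market

variable (M : Market G T)

/-- Deterministic convergence of the iterates along a good realization. -/
theorem exists_tendsto_solSet (hα : ∀ i, 0 < α i) (hβ : ∀ e ∈ G.edgeSet, 0 < β e)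
    (hstep : ∀ i, ∀ c : G.neighborSet i × Fin T, M.a i c / 2 + β s(i, c.1.1) ≤ (α i)⁻¹)
    (hne : ∀ i, (M.localSet i).Nonempty) {p : Stack G T} (hp : M.Reciprocal p)
    {P θ : Fin m → ℝ} {V Vh : ℕ → State G T} {a : ℕ → Fin m} {τ : ℕ → Fin m → ℕ}
    {ς : ℕ → Sym2 (Fin m) → ℕ} (hτ : ∀ k i, τ k i ≤ d) (hς : ∀ k, ∀ e ∈ G.edgeSet, ς k e ≤ d)
    (hVh : ∀ k, Vh k = delayed V k (τ k) (ς k))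
    (hV : ∀ k, V (k + 1) = M.asynStep α β θ (a k) (V k) (Vh k))
    {D : Set (State G T)} (hDsol : D ⊆ M.solSet) (hD : M.solSet ⊆ closure D)
    (hDne : D.Nonempty)
    (hconv : ∀ Us ∈ D,
      ∃ c, Tendsto (fun k => normSqTheta G α β P d (stackV V d k - fun _ => Us)) atTop (𝓝 c))
    (hdec : ∀ Us ∈ D, Tendsto (fun k => M.decrease α β (Vh k) Us) atTop (𝓝 0)) :
    ∃ Us ∈ M.solSet, Tendsto V atTop (𝓝 Us) := by
  obtain ⟨Us, hUsD⟩ := hDne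
  have hUs := hDsol hUsD
  obtain ⟨K, hK0, hK⟩ := exists_norm_sq_le (T := T) hα hβ
  have hle : ∀ X k, normSqTs G α β (V k - X)
      ≤ normSqTheta G α β P d (stackV V d k - fun _ => X) := fun X k => by
    rw [normSqTheta_stackV]
    refine le_add_of_nonneg_right (mul_nonneg (Real.sqrt_nonneg _) (Finset.sum_nonneg
      fun l hl => mul_nonneg ?_ (normSqTs_nonneg hα hβ _)))
    have : (l : ℝ) ≤ d := by exact_mod_cast (Finset.mem_range.1 hl).le
    linarith
  obtain ⟨C, hC0, hC⟩ : ∃ C, 0 ≤ C ∧ ∀ k, ‖V k‖ ≤ C := by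
    obtain ⟨c, hc⟩ := hconv Us hUsD
    obtain ⟨B, hB⟩ := hc.bddAbove_range
    refine ⟨√(K * B) + ‖Us‖, by positivity, fun k => ?_⟩
    have h1 : ‖V k - Us‖ ≤ √(K * B) := (hK _).trans (Real.sqrt_le_sqrt
      (mul_le_mul_of_nonneg_left ((hle Us k).trans (hB ⟨k, rfl⟩)) hK0))
    calc ‖V k‖ = ‖(V k - Us) + Us‖ := by rw [sub_add_cancel]
      _ ≤ _ := (norm_add_le _ _).trans (by linarith)
  have hCh : ∀ k, ‖Vh k‖ ≤ C := fun k => by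
    rw [hVh]
    exact norm_delayed_le _ _ _ _ hC0 (fun _ => hC _) fun _ _ => hC _
  have hZc := M.continuous_Zop α β hne
  -- By compactness it is enough that decrease and ℤ are continuous and that ℤ vanishes wherever
  -- decrease does; no rate is needed.
  have hZ : Tendsto (fun k => M.Zop α β (Vh k)) atTop (𝓝 0) :=
    tendsto_zero_of_tendsto_zero (M.continuous_decrease hne Us) hZc
      (fun x hx => (M.mem_solSet_of_decrease_eq_zero hβ hα hstep hne hUs hp hx).2) hCh
      (hdec Us hUsD)
  have hdiff : Tendsto (fun k => V (k + 1) - V k) atTop (𝓝 0) := by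
    have h1 : ∀ i, Tendsto (fun k => ‖θ i • owned i (M.Zop α β (Vh k))‖) atTop (𝓝 0) := by
      intro i
      have hc : Continuous fun X : State G T => ‖θ i • owned i X‖ := by fun_prop
      have h0 : ‖θ i • owned i (0 : State G T)‖ = 0 := by
        have : owned i (0 : State G T) = 0 := by
          refine Prod.ext ?_ ?_ <;> ext i' c <;> simp [owned]
        rw [this, smul_zero, norm_zero]
      rw [← h0]
      exact (hc.tendsto 0).comp hZ
    have h2 : Tendsto (fun k => ∑ i, ‖θ i • owned i (M.Zop α β (Vh k))‖) atTop (𝓝 0) := by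
      simpa using tendsto_finsetSum Finset.univ fun i _ => h1 i
    refine squeeze_zero_norm (fun k => ?_) h2
    rw [hV, asynStep_eq, sub_sub_cancel_left, norm_neg]
    exact Finset.single_le_sum (f := fun i => ‖θ i • owned i (M.Zop α β (Vh k))‖)
      (fun _ _ => norm_nonneg _) (Finset.mem_univ (a k))
  have hdel : Tendsto (fun k => Vh k - V k) atTop (𝓝 0) := by
    have h2 : Tendsto (fun k => ∑ l ∈ Finset.range d, ‖V (k - l) - V (k - (l + 1))‖)
        atTop (𝓝 0) := by
      simpa using tendsto_finsetSum (Finset.range d) fun l _ => (tendsto_sub_succ hdiff l).norm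
    refine squeeze_zero_norm (fun k => ?_) h2
    -- Subtracting the current state commutes with delaying, so the delay error is itself a delayed
    -- state of a small sequence.
    have : Vh k - V k = delayed (fun n => V n - V k) k (τ k) (ς k) := by
      rw [hVh]
      rfl
    rw [this]
    exact norm_delayed_le _ _ _ _ (Finset.sum_nonneg fun _ _ => norm_nonneg _)
      (fun i => norm_sub_le_sum V k (hτ k i)) fun e he => norm_sub_le_sum V k (hς k e he)
  obtain ⟨x, -, φ, hφ, hlim⟩ := (isCompact_closedBall (0 : State G T) C).tendsto_subseq
    (x := Vh) fun n => by simpa using hCh n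
  have hx : x ∈ M.solSet := by
    have : M.decrease α β x Us = 0 := tendsto_nhds_unique
      (((M.continuous_decrease hne Us).tendsto x).comp hlim) ((hdec Us hUsD).comp hφ.tendsto_atTop)
    exact (M.mem_solSet_of_decrease_eq_zero hβ hα hstep hne hUs hp this).1
  have hlimV : Tendsto (fun n => V (φ n)) atTop (𝓝 x) := by
    have := hlim.sub (hdel.comp hφ.tendsto_atTop)
    simpa using this
  -- The increments in the Θ-norm vanish in the limit, so the plain distance to y converges, and the
  -- subsequence tending to x identifies the limit.
  have hdist : ∀ y ∈ D, Tendsto (fun k => normSqTs G α β (V k - y)) atTop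
      (𝓝 (normSqTs G α β (x - y))) := by
    intro y hy
    obtain ⟨c, hc⟩ := hconv y hy
    have h1 : Tendsto (fun k => √(Pmin P / kappaS G α β T) * ∑ l ∈ Finset.range d,
        ((d : ℝ) - l) * normSqTs G α β (V (k - l) - V (k - (l + 1)))) atTop (𝓝 0) := by
      have h2 : ∀ l, Tendsto (fun k => ((d : ℝ) - l) *
          normSqTs G α β (V (k - l) - V (k - (l + 1)))) atTop (𝓝 0) := by
        intro l
        have := ((continuous_normSqTs (G := G) (T := T) (α := α) (β := β)).tendsto 0).comp
          (tendsto_sub_succ hdiff l)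
        rw [normSqTs_zero] at this
        simpa using this.const_mul ((d : ℝ) - l)
      have h3 := tendsto_finsetSum (Finset.range d) fun l _ => h2 l
      simpa using h3.const_mul (√(Pmin P / kappaS G α β T))
    have h4 : Tendsto (fun k => normSqTs G α β (V k - y)) atTop (𝓝 c) := by
      have := hc.sub h1
      simpa [normSqTheta_stackV] using this
    have h5 : Tendsto (fun n => normSqTs G α β (V (φ n) - y)) atTop
        (𝓝 (normSqTs G α β (x - y))) :=
      (continuous_normSqTs.tendsto _).comp (hlimV.sub_const y)
    rwa [← tendsto_nhds_unique (h4.comp hφ.tendsto_atTop) h5]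
  -- The cluster point x need not lie in D, so its distance is controlled through a nearby y in D.
  -- The factor 4 is twice the constant 2 of `normSqTs_add_le`, as ‖x - y‖² enters twice.
  have hfin : Tendsto (fun k => normSqTs G α β (V k - x)) atTop (𝓝 0) := by
    refine tendsto_order.2 ⟨fun b hb => Eventually.of_forall fun k =>
      hb.trans_le (normSqTs_nonneg hα hβ _), fun ε hε => ?_⟩
    have hopen : IsOpen {y : State G T | 4 * normSqTs G α β (x - y) < ε} :=
      isOpen_lt (continuous_const.mul (continuous_normSqTs.comp (by fun_prop))) continuous_const
    obtain ⟨y, hy, hyD⟩ := mem_closure_iff.1 (hD hx) _ hopen (by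
      simpa [normSqTs_zero] using hε)
    have h6 : ∀ᶠ k in atTop, 2 * normSqTs G α β (V k - y) + 2 * normSqTs G α β (x - y) < ε := by
      have := ((hdist y hyD).const_mul 2).add_const (2 * normSqTs G α β (x - y))
      refine this.eventually_lt_const ?_
      have hy' : 4 * normSqTs G α β (x - y) < ε := hy
      linarith
    filter_upwards [h6] with k hk
    refine lt_of_le_of_lt ?_ hk
    have := normSqTs_add_le hα hβ (V k - y) (y - x)
    rwa [sub_add_sub_cancel, ← neg_sub x y, normSqTs_neg] at this
  refine ⟨x, hx, tendsto_iff_norm_sub_tendsto_zero.2 ?_⟩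
  have h7 : Tendsto (fun k => √(K * normSqTs G α β (V k - x))) atTop (𝓝 0) := by
    have := (Real.continuous_sqrt.tendsto _).comp (hfin.const_mul K)
    rwa [mul_zero, Real.sqrt_zero] at this
  exact squeeze_zero (fun _ => norm_nonneg _) (fun k => hK _) h7

end Market

end DYNA

/-! ### The conditional inequality and the theorem -/

namespace DYNA

variable {m T d : ℕ} {G : SimpleGraph (Fin m)} [DecidableRel G.Adj]
  {Ω : Type*} [MeasurableSpace Ω] (M : Market G T) {α : Fin m → ℝ} {β : Sym2 (Fin m) → ℝ}
  {act : ℕ → Ω → Fin m} {τ : ℕ → Ω → Fin m → ℕ} {ς : ℕ → Ω → Sym2 (Fin m) → ℕ} {θ : Fin m → ℝ}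
  {U Uh : ℕ → Ω → State G T} {U₀ : State G T} {μ : Measure Ω} [IsProbabilityMeasure μ]
  {P : Fin m → ℝ}

theorem sum_probabilities (hact : ∀ k, Measurable (act k))
    (hactP : ∀ k i, μ.real {ω | act k ω = i} = P i) : ∑ i, P i = 1 := by
  have := sum_measureReal_preimage_singleton (μ := μ) (f := act 0) Finset.univ
    (fun i _ => hact 0 (measurableSet_singleton i))
  rw [Finset.coe_univ, Set.preimage_univ, probReal_univ] at this
  rw [← this]
  exact Finset.sum_congr rfl fun i _ => (hactP 0 i).symm

/-- A single agent would be activated with probability 1, so P_i < 1 forces at least two agents, and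
connectivity then gives each one a neighbour. -/
theorem nonempty_block_index (hT : 0 < T) (hG : G.Connected) (hP : ∀ i, 0 < P i ∧ P i < 1)
    (hPsum : ∑ i, P i = 1) (i : Fin m) : Nonempty (G.neighborSet i × Fin T) := by
  have : Nontrivial (Fin m) := by
    by_contra hnt
    rw [not_nontrivial_iff_subsingleton] at hnt
    have : ∑ j, P j = P i := Finset.sum_eq_single i
      (fun j _ hj => absurd (Subsingleton.elim j i) hj) (by simp)
    linarith [(hP i).2]
  obtain ⟨j, hj⟩ := hG.preconnected.exists_adj_of_nontrivial i
  exact ⟨⟨⟨j, hj⟩, ⟨0, hT⟩⟩⟩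

section Step

variable (hne : ∀ i, (M.localSet i).Nonempty) (hact : ∀ k, Measurable (act k))
  (hτm : ∀ k i, Measurable fun ω => τ k ω i)
  (hςm : ∀ k, ∀ e ∈ G.edgeSet, Measurable fun ω => ς k ω e) (hU₀ : ∀ ω, U 0 ω = U₀)
  (hUh : ∀ k ω, Uh k ω = delayed (fun n => U n ω) k (τ k ω) (ς k ω))
  (hU : ∀ k ω, U (k + 1) ω = M.asynStep α β θ (act k ω) (U k ω) (Uh k ω))
include hne hact hτm hςm hU₀ hUh hU

theorem stronglyMeasurable_normSqTheta (Us : State G T) (k : ℕ) :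
    StronglyMeasurable[hist U Uh k]
      (fun ω => normSqTheta G α β P d (stackV (fun n => U n ω) d k - fun _ => Us)) ∧
    Integrable (fun ω => normSqTheta G α β P d (stackV (fun n => U n ω) d k - fun _ => Us)) μ := by
  simp only [normSqTheta_stackV]
  have hN := continuous_normSqTs (G := G) (T := T) (α := α) (β := β)
  refine stronglyMeasurable_and_integrable M hne hact hτm hςm hU₀ hUh hU k
    (φ := fun p => normSqTs G α β (p.2 (Fin.last k) - Us) + √(Pmin P / kappaS G α β T) *
        ∑ l ∈ Finset.range d, ((d : ℝ) - l) *
          normSqTs G α β (p.2 ⟨k - l, Nat.lt_succ_of_le (Nat.sub_le _ _)⟩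
            - p.2 ⟨k - (l + 1), Nat.lt_succ_of_le (Nat.sub_le _ _)⟩)) ?_
  fun_prop

theorem stronglyMeasurable_decrease (Us : State G T) (k : ℕ) :
    StronglyMeasurable[hist U Uh k] (fun ω => M.decrease α β (Uh k ω) Us) ∧
    Integrable (fun ω => M.decrease α β (Uh k ω) Us) μ :=
  stronglyMeasurable_and_integrable M hne hact hτm hςm hU₀ hUh hU k
    (φ := fun p => M.decrease α β p.1 Us) ((M.continuous_decrease hne Us).comp continuous_fst)

/-- The conditional decrease of the distance to a fixed state. -/
theorem condExp_normSqTheta_le (hα : ∀ i, 0 < α i) (hβ : ∀ e ∈ G.edgeSet, 0 < β e)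
    (hκ : 1 ≤ kappaS G α β T) (hP : ∀ i, 0 < P i)
    (hactP : ∀ k i, μ.real {ω | act k ω = i} = P i) {q : ℝ} (hq0 : 0 < q)
    (hq : ∀ i, θ i * P i = q) (hτ : ∀ k ω i, τ k ω i ≤ d)
    (hς : ∀ k ω, ∀ e ∈ G.edgeSet, ς k ω e ≤ d)
    (hpast : ∀ k, Indep (MeasurableSpace.comap (act k) inferInstance) (hist U Uh k) μ)
    (Us : State G T) (k : ℕ) (i₀ : Fin m) :
    ∀ᵐ ω ∂μ, (μ[fun ω' => normSqTheta G α β P d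
        (stackV (fun n => U n ω') d (k + 1) - fun _ => Us) | hist U Uh k]) ω ≤
      normSqTheta G α β P d (stackV (fun n => U n ω) d k - fun _ => Us)
        - q * M.decrease α β (Uh k ω) Us
        - varpi G α β T P θ d i₀ * q ^ 2 * normSqTs G α β (M.Zop α β (Uh k ω)) := by
  have hm := fun k => measurable_iterates M hne hact hτm hςm hU₀ hUh hU k
  -- `H i` is the next Θ-distance if agent i were activated. It depends only on the history, so the
  -- sole fresh randomness is the index.
  set H : Fin m → Ω → ℝ := fun i ω =>
    normSqTs G α β (M.asynStep α β θ i (U k ω) (Uh k ω) - Us)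
      + √(Pmin P / kappaS G α β T) *
        (d * normSqTs G α β (M.asynStep α β θ i (U k ω) (Uh k ω) - U k ω)
        + ∑ l ∈ Finset.range d,
          ((d : ℝ) - l - 1) * normSqTs G α β (U (k - l) ω - U (k - (l + 1)) ω)) with hH
  have hX : (fun ω' => normSqTheta G α β P d
      (stackV (fun n => U n ω') d (k + 1) - fun _ => Us)) = fun ω => H (act k ω) ω := by
    ext ω
    rw [normSqTheta_stackV_succ, hU]
  have hHm : ∀ i, StronglyMeasurable[hist U Uh k] (H i) ∧ Integrable (H i) μ := by
    intro i
    have hN := continuous_normSqTs (G := G) (T := T) (α := α) (β := β)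
    have hA := M.continuous_asynStep α β hne θ i
    have hA' : Continuous fun p : State G T × (Fin (k + 1) → State G T) =>
        M.asynStep α β θ i (p.2 (Fin.last k)) p.1 :=
      hA.comp (f := fun p : State G T × (Fin (k + 1) → State G T) => (p.2 (Fin.last k), p.1))
        (by fun_prop)
    refine stronglyMeasurable_and_integrable M hne hact hτm hςm hU₀ hUh hU k
      (φ := fun p => normSqTs G α β (M.asynStep α β θ i (p.2 (Fin.last k)) p.1 - Us)
        + √(Pmin P / kappaS G α β T) * (d * normSqTs G α β
            (M.asynStep α β θ i (p.2 (Fin.last k)) p.1 - p.2 (Fin.last k))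
        + ∑ l ∈ Finset.range d, ((d : ℝ) - l - 1) *
          normSqTs G α β (p.2 ⟨k - l, Nat.lt_succ_of_le (Nat.sub_le _ _)⟩
            - p.2 ⟨k - (l + 1), Nat.lt_succ_of_le (Nat.sub_le _ _)⟩))) ?_
    generalize (fun p : State G T × (Fin (k + 1) → State G T) =>
        M.asynStep α β θ i (p.2 (Fin.last k)) p.1) = A at hA'
    fun_prop
  have hcond := (condExp_apply_index (hist_le (fun k => (hm k).1) (fun k => (hm k).2) k)
    (hact k) (hpast k) (fun i => (hHm i).1) fun i => (hHm i).2).2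
  rw [hX]
  filter_upwards [hcond] with ω hω
  rw [hω]
  simp only [hactP]
  have := M.sum_asynStep_le hα hβ hκ hP (sum_probabilities hact hactP) hq0 hq Us
    (fun n => U n ω) k (hτ k ω) (hς k ω) i₀
  rw [← hUh] at this
  exact this

end Step

end DYNA

theorem theorem2 {m T d : ℕ} (hT : 0 < T)
    -- the network
    (G : SimpleGraph (Fin m)) [DecidableRel G.Adj] (hG : G.Connected)
    -- the problem: solvability and strict feasibility
    (M : Market G T) (hsol : ∃ p, M.IsSolution p) (hslater : ∃ p, M.StrictlyFeasible p)
    -- the step-sizes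
    (α : Fin m → ℝ) (β : Sym2 (Fin m) → ℝ) (hβ : ∀ e ∈ G.edgeSet, 0 < β e)
    (hα : ∀ i, 0 < α i ∧ α i ≤ 1 / (M.kappaF * (M.Lf / 2) + couplingNorm G β T i))
    -- random activation
    {Ω : Type*} [MeasurableSpace Ω] (μ : Measure Ω) [IsProbabilityMeasure μ]
    (act : ℕ → Ω → Fin m) (hact : ∀ k, Measurable (act k))
    (P : Fin m → ℝ) (hP : ∀ i, 0 < P i ∧ P i < 1)
    (hactP : ∀ k i, μ.real {ω | act k ω = i} = P i) (hindep : iIndepFun act μ)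
    -- bounded delays
    (τ : ℕ → Ω → Fin m → ℕ) (ς : ℕ → Ω → Sym2 (Fin m) → ℕ)
    (hτm : ∀ k i, Measurable fun ω => τ k ω i)
    (hςm : ∀ k, ∀ e ∈ G.edgeSet, Measurable fun ω => ς k ω e)
    (hτ : ∀ k ω i, τ k ω i ≤ d) (hς : ∀ k ω, ∀ e ∈ G.edgeSet, ς k ω e ≤ d)
    -- the relaxation factors
    (θ : Fin m → ℝ)
    (hθ : ∀ i, 0 < θ i ∧
      θ i ≤ 1 / (2 * d * √(kappaS G α β T * kappaP P) + kappaS G α β T * kappaP P))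
    (θt : ℝ) (hθt : ∀ i, θt = m * θ i * P i)
    -- the iterates of Asyn-DYNA and the delayed states
    (U Uh : ℕ → Ω → State G T) (U₀ : State G T) (hU₀ : ∀ ω, U 0 ω = U₀)
    (hUh : ∀ k ω, Uh k ω = delayed (fun n => U n ω) k (τ k ω) (ς k ω))
    (hU : ∀ k ω, U (k + 1) ω = M.asynStep α β θ (act k ω) (U k ω) (Uh k ω))
    -- each activation is independent of the past
    (hpast : ∀ k, Indep (MeasurableSpace.comap (act k) inferInstance) (hist U Uh k) μ) :
    (∀ i, 0 ≤ varpi G α β T P θ d i) ∧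
    (∀ Us ∈ M.solSet, ∀ k,
      Integrable (fun ω => normSqTheta G α β P d
        (stackV (fun n => U n ω) d (k + 1) - fun _ => Us)) μ ∧
      ∀ i, ∀ᵐ ω ∂μ,
        (μ[fun ω' => normSqTheta G α β P d
            (stackV (fun n => U n ω') d (k + 1) - fun _ => Us) | hist U Uh k]) ω ≤
          normSqTheta G α β P d (stackV (fun n => U n ω) d k - fun _ => Us)
            - varpi G α β T P θ d i / (m : ℝ) ^ 2
              * normSqTs G α β (M.virtual α β θt (U k ω) (Uh k ω) - U k ω)) ∧
    ∀ᵐ ω ∂μ, ∃ Us ∈ M.solSet, Tendsto (fun k => U k ω) atTop (𝓝 Us) := by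
  have hα' : ∀ i, 0 < α i := fun i => (hα i).1
  have hPsum : ∑ i, P i = 1 := sum_probabilities hact hactP
  have hblock := nonempty_block_index hT hG hP hPsum
  obtain ⟨i₀⟩ : Nonempty (Fin m) := hG.nonempty
  have hκ : 1 ≤ kappaS G α β T := one_le_kappaS hα' hβ ⟨i₀, hblock i₀⟩
  have hvarpi : ∀ i, 0 ≤ varpi G α β T P θ d i := varpi_nonneg hκ hP hθ
  obtain ⟨p, hp⟩ := hsol
  have hne : ∀ i, (M.localSet i).Nonempty := fun i => ⟨p i, hp.1.2 i⟩
  have hstep := M.inv_alpha_ge hβ hα hblock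
  have hm0 : (m : ℝ) ≠ 0 := by
    rintro h
    have : m = 0 := by exact_mod_cast h
    subst this
    exact i₀.elim0
  have hq : ∀ i, θ i * P i = θt / m := fun i => by
    rw [hθt i]
    field_simp
  have hq0 : 0 < θt / m := by
    rw [← hq i₀]
    exact mul_pos (hθ i₀).1 (hP i₀).1
  have hmain := condExp_normSqTheta_le (μ := μ) (P := P) (d := d) M hne hact hτm hςm hU₀ hUh hU
    hα' hβ hκ (fun i => (hP i).1) hactP hq0 hq hτ hς hpast
  have hX := stronglyMeasurable_normSqTheta (μ := μ) (P := P) (d := d) M hne hact hτm hςm hU₀ hUh hU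
  have hN0 : ∀ X : State G T, 0 ≤ normSqTs G α β X := normSqTs_nonneg hα' hβ
  refine ⟨hvarpi, fun Us hUs k => ⟨(hX Us (k + 1)).2, fun i => ?_⟩, ?_⟩
  · filter_upwards [hmain Us k i] with ω hω
    refine hω.trans ?_
    have h1 := mul_nonneg hq0.le (M.decrease_nonneg hβ hα' hstep hne hUs hp.1.1 (Uh k ω))
    have h2 : varpi G α β T P θ d i / (m : ℝ) ^ 2
        * normSqTs G α β (M.virtual α β θt (U k ω) (Uh k ω) - U k ω)
        = varpi G α β T P θ d i * (θt / m) ^ 2 * normSqTs G α β (M.Zop α β (Uh k ω)) := by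
      rw [Market.virtual, sub_sub_cancel_left, normSqTs_neg, normSqTs_smul]
      ring
    rw [h2]
    linarith
  -- The exceptional null set depends on the solution considered, so a countable dense set of
  -- solutions is fixed beforehand.
  · obtain ⟨D, hDsol, hDc, hD⟩ :=
      (TopologicalSpace.IsSeparable.of_separableSpace M.solSet).exists_countable_dense_subset
    have hDne : D.Nonempty := by
      obtain ⟨x, hx⟩ := M.solSet_nonempty ⟨p, hp⟩ hslater
      exact closure_nonempty_iff.1 ⟨x, hD hx⟩
    have hmeas := fun k => measurable_iterates M hne hact hτm hςm hU₀ hUh hU k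
    set ℱ : Filtration ℕ ‹MeasurableSpace Ω› :=
      ⟨hist U Uh, hist_mono, hist_le (fun k => (hmeas k).1) fun k => (hmeas k).2⟩
    have hconv : ∀ᵐ ω ∂μ, ∀ Us ∈ D,
        (∃ c, Tendsto (fun k => normSqTheta G α β P d
          (stackV (fun n => U n ω) d k - fun _ => Us)) atTop (𝓝 c)) ∧
        Tendsto (fun k => θt / m * M.decrease α β (Uh k ω) Us) atTop (𝓝 0) := by
      refine (ae_ball_iff hDc).2 fun Us hUs => ?_
      have hdec := stronglyMeasurable_decrease (μ := μ) M hne hact hτm hςm hU₀ hUh hU Us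
      -- The summable quantity is q · decrease; the ϖ term is discarded, since ϖ may be 0.
      refine exists_tendsto_of_condExp_le (ℱ := ℱ)
        (X := fun k ω => normSqTheta G α β P d (stackV (fun n => U n ω) d k - fun _ => Us))
        (Y := fun k ω => θt / m * M.decrease α β (Uh k ω) Us)
        (fun k ω => normSqTheta_nonneg hα' hβ P _ k Us)
        (fun k ω => mul_nonneg hq0.le
          (M.decrease_nonneg hβ hα' hstep hne (hDsol hUs) hp.1.1 (Uh k ω)))
        (fun k => (hX Us k).1) (fun k => (hdec k).1.const_mul _)
        (fun k => (hX Us k).2) (fun k => (hdec k).2.const_mul _) fun k => ?_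
      filter_upwards [hmain Us k i₀] with ω hω
      refine hω.trans (sub_le_self _ ?_)
      exact mul_nonneg (mul_nonneg (hvarpi i₀) (sq_nonneg _)) (hN0 _)
    filter_upwards [hconv] with ω hω
    refine M.exists_tendsto_solSet hα' hβ hstep hne hp.1.1 (P := P) (hτ := fun k => hτ k ω)
      (hς := fun k => hς k ω) (V := fun n => U n ω) (Vh := fun n => Uh n ω)
      (hVh := fun k => hUh k ω) (hV := fun k => hU k ω) hDsol hD hDne (fun Us hUs => (hω Us hUs).1)
      fun Us hUs => ?_
    have := (hω Us hUs).2.const_mul (θt / m)⁻¹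
    simp only [mul_zero, inv_mul_cancel_left₀ hq0.ne'] at this
    exact this
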